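/- Let $p_-,p_+,\Omega>0$, and let $p(x)=p_-$ for $x\le 0$ and $p(x)=p_+$ for $x>0$. Let $A_p f=-(pf')'$ be the (self-adjoint) maximal operator on $L^2(\mathbb R)$, with domain $\{f\in L^2(\mathbb R): f,\,pf'\in AC_{\mathrm{loc}}(\mathbb R),\ (pf')'\in L^2(\mathbb R)\}$, and let $PW_{[0,\Omega]}(A_p)$ be the range of its spectral projection $\mathbf 1_{[0,\Omega]}(A_p)$. Write $\operatorname{sinc}t=\sin t/t$ with $\operatorname{sinc}0=1$. Every element of $PW_{[0,\Omega]}(A_p)$ has a continuous representative, and with these representatives $PW_{[0,\Omega]}(A_p)$ is a reproducing kernel Hilbert space, whose kernel is $$k(x,y)=\begin{cases} \frac{\Omega^{1/2}}{\pi\sqrt{p_-}}\operatorname{sinc}\!\big(\Omega^{1/2}\tfrac{x-y}{\sqrt{p_-}}\big)-\frac{\sqrt{p_+}-\sqrt{p_-}}{\sqrt{p_+}+\sqrt{p_-}}\,\frac{\Omega^{1/2}}{\pi\sqrt{p_-}}\operatorname{sinc}\!\big(\Omega^{1/2}\tfrac{x+y}{\sqrt{p_-}}\big), & x,y\le 0,\\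 \frac{\Omega^{1/2}}{\pi\sqrt{p_+}}\operatorname{sinc}\!\big(\Omega^{1/2}\tfrac{x-y}{\sqrt{p_+}}\big)+\frac{\sqrt{p_+}-\sqrt{p_-}}{\sqrt{p_+}+\sqrt{p_-}}\,\frac{\Omega^{1/2}}{\pi\sqrt{p_+}}\operatorname{sinc}\!\big(\Omega^{1/2}\tfrac{x+y}{\sqrt{p_+}}\big), & x,y>0,\\ \frac{2\Omega^{1/2}}{\pi(\sqrt{p_+}+\sqrt{p_-})}\operatorname{sinc}\!\big(\Omega^{1/2}(\tfrac{x}{\sqrt{p_-}}-\tfrac{y}{\sqrt{p_+}})\big), & x\le 0<y,\\ \frac{2\Omega^{1/2}}{\pi(\sqrt{p_+}+\sqrt{p_-})}\operatorname{sinc}\!\big(\Omega^{1/2}(\tfrac{x}{\sqrt{p_+}}-\tfrac{y}{\sqrt{p_-}})\big), & y\le 0<x. \end{cases}$$ For $j\in\mathbb Z$ let $x_j=\dfrac{\pi j\sqrt{p(j)}}{\Omega^{1/2}}$, and let $w_j=\sqrt{p_-}$ for $j<0$, $w_j=\sqrt{p_+}$ for $j>0$, and $w_0=\tfrac12(\sqrt{p_+}+\sqrt{p_-})$.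 Then $\Big\{\sqrt{\tfrac{\pi w_j}{\Omega^{1/2}}}\,k(x_j,\cdot): j\in\mathbb Z\Big\}$ is an orthonormal basis of $PW_{[0,\Omega]}(A_p)$, and for every $f\in PW_{[0,\Omega]}(A_p)$ (continuous representative) the expansion $$f(x)=\frac{\pi}{\Omega^{1/2}}\sum_{j\in\mathbb Z}w_j\,f(x_j)\,k(x_j,x)$$ converges unconditionally in $L^2(\mathbb R)$ and uniformly on $\mathbb R$. -/

import Mathlib

open MeasureTheory Set Filter Topology
open scoped ENNReal

/-! ### Projection-valued measures and spectral projections of unbounded operators -/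

/-- A projection-valued (spectral) measure on the Borel sets of `ℝ`, acting on `H`: its values are
orthogonal projections, it is multiplicative on intersections, normalised, and countably additive in
the strong operator topology. As with Mathlib's vector measures, it is `0` on non-measurable sets. -/
structure ProjValuedMeasure (H : Type*) [NormedAddCommGroup H] [InnerProductSpace ℂ H]
    [CompleteSpace H] where
  proj : Set ℝ → H →L[ℂ] H
  isStarProjection : ∀ s, IsStarProjection (proj s)
  not_measurable : ∀ s, ¬ MeasurableSet s → proj s = 0
  proj_univ : proj univ = 1
  proj_inter : ∀ s t, MeasurableSet s → MeasurableSet t → proj (s ∩ t) = proj s * proj t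
  hasSum_iUnion : ∀ s : ℕ → Set ℝ, (∀ n, MeasurableSet (s n)) → Pairwise (Function.onFun Disjoint s) →
    ∀ f : H, HasSum (fun n => proj (s n) f) (proj (⋃ n, s n) f)

namespace ProjValuedMeasure

variable {H : Type*} [NormedAddCommGroup H] [InnerProductSpace ℂ H] [CompleteSpace H]

theorem inner_proj (E : ProjValuedMeasure H) (s : Set ℝ) (f : H) :
    inner ℂ f (E.proj s f) = ((‖E.proj s f‖ ^ 2 : ℝ) : ℂ) := by
  have h := E.isStarProjection s
  have h1 : E.proj s (E.proj s f) = E.proj s f :=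
    congrArg (fun T : H →L[ℂ] H => T f) h.isIdempotentElem
  have h2 : ContinuousLinearMap.adjoint (E.proj s) = E.proj s := h.isSelfAdjoint
  calc inner ℂ f (E.proj s f) = inner ℂ f (E.proj s (E.proj s f)) := by rw [h1]
    _ = inner ℂ (ContinuousLinearMap.adjoint (E.proj s) f) (E.proj s f) := by
        rw [ContinuousLinearMap.adjoint_inner_left]
    _ = inner ℂ (E.proj s f) (E.proj s f) := by rw [h2]
    _ = _ := by rw [inner_self_eq_norm_sq_to_K]; norm_cast

/-- The scalar spectral measure `s ↦ ⟨f, E(s) f⟩ = ‖E(s) f‖²` of a vector `f`. -/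
noncomputable def scalarMeasure (E : ProjValuedMeasure H) (f : H) : Measure ℝ :=
  Measure.ofMeasurable (fun s _ => ENNReal.ofReal (‖E.proj s f‖ ^ 2))
    (by
      have h := E.hasSum_iUnion (fun _ => ∅) (fun _ => MeasurableSet.empty)
        (fun _ _ _ => disjoint_bot_left) f
      have h0 : E.proj ∅ f = 0 := tendsto_nhds_unique tendsto_const_nhds h.summable.tendsto_atTop_zero
      simp [h0])
    (by
      intro s hs hd
      have h := (innerSL ℂ f).hasSum (E.hasSum_iUnion s hs hd f)
      simp only [innerSL_apply_apply, inner_proj] at h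
      have h' : HasSum (fun n => ‖E.proj (s n) f‖ ^ 2) (‖E.proj (⋃ n, s n) f‖ ^ 2) :=
        Complex.hasSum_ofReal.mp h
      rw [← h'.tsum_eq]
      exact ENNReal.ofReal_tsum_of_nonneg (fun _ => by positivity) h'.summable)

end ProjValuedMeasure

/-- `E` is the spectral measure of the operator `A`, i.e. `A = ∫ λ dE(λ)`: the domain of `A` is the
set of `f` with `∫ λ² d⟨f, E f⟩ < ∞`, and `⟨f, A f⟩ = ∫ λ d⟨f, E f⟩` on it. -/
structure IsSpectralMeasure {H : Type*} [NormedAddCommGroup H] [InnerProductSpace ℂ H]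
    [CompleteSpace H] (A : H →ₗ.[ℂ] H) (E : ProjValuedMeasure H) : Prop where
  mem_domain_iff : ∀ f : H,
    f ∈ A.domain ↔ ∫⁻ t, ENNReal.ofReal (t ^ 2) ∂(E.scalarMeasure f) < ∞
  inner_apply : ∀ f : A.domain,
    inner ℂ (f : H) (A f) = ((∫ t, t ∂(E.scalarMeasure (f : H)) : ℝ) : ℂ)

open Classical in
/-- The spectral projection `c_s(A)` of a self-adjoint operator `A`, taken from its (unique) spectral
measure; `0` if `A` has no spectral measure, i.e. is not self-adjoint. -/
noncomputable def spectralProjection {H : Type*} [NormedAddCommGroup H] [InnerProductSpace ℂ H]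
    [CompleteSpace H] (A : H →ₗ.[ℂ] H) (s : Set ℝ) : H →L[ℂ] H :=
  if h : ∃ E : ProjValuedMeasure H, IsSpectralMeasure A E then h.choose.proj s else 0

/-- The abstract Paley–Wiener space `PW_s(A)`: the range of the spectral projection `c_s(A)`. -/
noncomputable def paleyWiener {H : Type*} [NormedAddCommGroup H] [InnerProductSpace ℂ H]
    [CompleteSpace H] (A : H →ₗ.[ℂ] H) (s : Set ℝ) : Submodule ℂ H :=
  LinearMap.range (spectralProjection A s : H →ₗ[ℂ] H)

/-! ### The maximal operator `A_p f = -(p f')'` on `L²(ℝ)` -/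

/-- Complex-valued `L²(ℝ)` with respect to Lebesgue measure. -/
abbrev L2R : Type := Lp ℂ 2 (volume : Measure ℝ)

/-- Local absolute continuity on `ℝ`. -/
def LocallyAC (u : ℝ → ℂ) : Prop := ∀ a b : ℝ, AbsolutelyContinuousOnInterval u a b

theorem LocallyAC.continuous {u : ℝ → ℂ} (hu : LocallyAC u) : Continuous u := by
  rw [continuous_iff_continuousAt]
  intro x
  refine (hu (x - 1) (x + 1)).continuousOn.continuousAt ?_
  rw [uIcc_of_le (by linarith)]
  exact Icc_mem_nhds (by linarith) (by linarith)

theorem LocallyAC.ae_differentiableAt {u : ℝ → ℂ} (hu : LocallyAC u) :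
    ∀ᵐ x, DifferentiableAt ℝ u x := by
  have h : ∀ n : ℕ, ∀ᵐ x, x ∈ uIcc (-(n : ℝ)) n → DifferentiableAt ℝ u x :=
    fun n => (hu _ _).boundedVariationOn.ae_differentiableAt_of_mem_uIcc
  filter_upwards [ae_all_iff.mpr h] with x hx
  obtain ⟨n, hn⟩ := exists_nat_ge |x|
  refine hx n ?_
  rw [uIcc_of_le (by linarith [abs_nonneg x])]
  exact abs_le.mp hn

theorem LocallyAC.add {u v : ℝ → ℂ} (hu : LocallyAC u) (hv : LocallyAC v) : LocallyAC (u + v) :=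
  fun a b => (hu a b).add (hv a b)

theorem LocallyAC.const_smul {u : ℝ → ℂ} (c : ℂ) (hu : LocallyAC u) : LocallyAC (c • u) :=
  fun a b => (hu a b).const_smul c

/-- The graph of the maximal operator `A_p`: pairs `(f, -(p f')')` where `f` and `p f'` are locally
absolutely continuous (`u` and `v` below are these representatives), and `f`, `(p f')'` are in `L²`. -/
def sturmLiouvilleGraph (p : ℝ → ℝ) : Submodule ℂ (L2R × L2R) where
  carrier := {w | ∃ u v : ℝ → ℂ, LocallyAC u ∧ LocallyAC v ∧
    (w.1 : ℝ → ℂ) =ᵐ[volume] u ∧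
    (∀ᵐ x, v x = (p x : ℂ) * deriv u x) ∧
    (∀ᵐ x, (w.2 : ℝ → ℂ) x = - deriv v x)}
  zero_mem' := by
    have h0 : LocallyAC (fun _ => 0) := fun a b =>
      (LipschitzWith.const (0 : ℂ)).lipschitzOnWith.absolutelyContinuousOnInterval
    refine ⟨fun _ => 0, fun _ => 0, h0, h0, Lp.coeFn_zero _ _ _, by simp, ?_⟩
    filter_upwards [Lp.coeFn_zero ℂ 2 (volume : Measure ℝ)] with x hx
    simp_all
  add_mem' := by
    rintro a b ⟨u, v, hu, hv, h1, h2, h3⟩ ⟨u', v', hu', hv', h1', h2', h3'⟩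
    refine ⟨u + u', v + v', hu.add hu', hv.add hv', ?_, ?_, ?_⟩
    · exact (Lp.coeFn_add a.1 b.1).trans (h1.add h1')
    · filter_upwards [h2, h2', hu.ae_differentiableAt, hu'.ae_differentiableAt] with x k k' d d'
      rw [Pi.add_apply, deriv_add d d', k, k', mul_add]
    · filter_upwards [h3, h3', hv.ae_differentiableAt, hv'.ae_differentiableAt,
        Lp.coeFn_add a.2 b.2] with x k k' d d' e
      rw [deriv_add d d', neg_add, ← k, ← k']
      exact e
  smul_mem' := by
    rintro c a ⟨u, v, hu, hv, h1, h2, h3⟩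
    refine ⟨c • u, c • v, hu.const_smul c, hv.const_smul c, ?_, ?_, ?_⟩
    · exact (Lp.coeFn_smul c a.1).trans (h1.const_smul c)
    · filter_upwards [h2, hu.ae_differentiableAt] with x k d
      rw [Pi.smul_apply, deriv_const_smul c d, k, smul_eq_mul, smul_eq_mul]
      ring
    · filter_upwards [h3, hv.ae_differentiableAt, Lp.coeFn_smul c a.2] with x k d e
      rw [deriv_const_smul c d, ← smul_neg, ← k]
      exact e

theorem sturmLiouvilleGraph_single_valued (p : ℝ → ℝ) (w : L2R × L2R)
    (hw : w ∈ sturmLiouvilleGraph p) (h0 : w.1 = 0) : w.2 = 0 := by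
  obtain ⟨u, v, hu, hv, h1, h2, h3⟩ := hw
  have hu0 : u = fun _ => 0 := by
    refine Measure.eq_of_ae_eq (μ := volume) ?_ hu.continuous continuous_const
    refine h1.symm.trans ?_
    rw [h0]
    exact Lp.coeFn_zero _ _ _
  have hv0 : v = fun _ => 0 := by
    refine Measure.eq_of_ae_eq (μ := volume) ?_ hv.continuous continuous_const
    filter_upwards [h2] with x hx
    simpa [hu0] using hx
  refine (Lp.eq_zero_iff_ae_eq_zero).mpr ?_
  filter_upwards [h3] with x hx
  simpa [hv0] using hx

/-- The maximal operator `A_p f = -(p f')'` on `L²(ℝ)`. -/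
noncomputable def sturmLiouville (p : ℝ → ℝ) : L2R →ₗ.[ℂ] L2R :=
  (sturmLiouvilleGraph p).toLinearPMap

theorem sturmLiouville_graph (p : ℝ → ℝ) :
    (sturmLiouville p).graph = sturmLiouvilleGraph p :=
  Submodule.toLinearPMap_graph_eq _ (fun w hw h0 => sturmLiouvilleGraph_single_valued p w hw h0)

/-! ### Spaces of continuous functions in `L²(ℝ)` and reproducing kernels -/

/-- The continuous functions on `ℝ` whose class in `L²(ℝ)` belongs to `V`. -/
def continuousElements (V : Submodule ℂ L2R) : Set (ℝ → ℂ) :=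
  {u | Continuous u ∧ ∃ f ∈ V, (f : ℝ → ℂ) =ᵐ[volume] u}

/-- Every element of `V` has a continuous representative, and with these representatives `V` is a
reproducing kernel Hilbert space with kernel `k`: `u x = ⟨u, k(x, ·)⟩`. -/
structure IsReproducingKernel (V : Submodule ℂ L2R) (k : ℝ → ℝ → ℂ) : Prop where
  exists_continuous : ∀ f ∈ V, ∃ u : ℝ → ℂ, Continuous u ∧ (f : ℝ → ℂ) =ᵐ[volume] u
  kernel_mem : ∀ x, k x ∈ continuousElements V
  reproducing : ∀ u ∈ continuousElements V, ∀ x, u x = ∫ y, u y * (starRingEnd ℂ) (k x y)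

/-! ### The two-valued parametrizing function -/

/-- `p = p₋` on `x ≤ 0` and `p = p₊` on `x > 0`. -/
noncomputable def toyP (pm pp : ℝ) (x : ℝ) : ℝ := if x ≤ 0 then pm else pp

open Real in
/-- The explicit kernel `k(x, y)`; here `Real.sinc t = sin t / t` and `Real.sinc 0 = 1`. -/
noncomputable def toyKernel (pm pp Ω : ℝ) (x y : ℝ) : ℂ :=
  ((if x ≤ 0 then
      if y ≤ 0 then
        √Ω / (π * √pm) * sinc (√Ω * ((x - y) / √pm))
          - (√pp - √pm) / (√pp + √pm) * (√Ω / (π * √pm)) * sinc (√Ω * ((x + y) / √pm))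
      else
        2 * √Ω / (π * (√pp + √pm)) * sinc (√Ω * (x / √pm - y / √pp))
    else
      if y ≤ 0 then
        2 * √Ω / (π * (√pp + √pm)) * sinc (√Ω * (x / √pp - y / √pm))
      else
        √Ω / (π * √pp) * sinc (√Ω * ((x - y) / √pp))
          + (√pp - √pm) / (√pp + √pm) * (√Ω / (π * √pp)) * sinc (√Ω * ((x + y) / √pp)) : ℝ) : ℂ)

/-- The sampling points `x_j = π j √p(j) / √Ω`. -/
noncomputable def toyPoint (pm pp Ω : ℝ) (j : ℤ) : ℝ :=
  Real.pi * j * √(toyP pm pp j) / √Ω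

/-- The weights `w_j`. -/
noncomputable def toyWeight (pm pp : ℝ) (j : ℤ) : ℝ :=
  if j < 0 then √pm else if 0 < j then √pp else (√pp + √pm) / 2

/-! ### Uniqueness of the spectral measure on bounded intervals -/

namespace ProjValuedMeasure

variable {H : Type*} [NormedAddCommGroup H] [InnerProductSpace ℂ H] [CompleteSpace H]

/-! The operator `A_p` is unitarily equivalent to `-d²/dt²` on `L²(ℝ)`, and everything is
transported from classical band-limited functions. Put `α = p₋^{1/4}`, `β = p₊^{1/4}`. Let `J F(t) =
sgn(t) F(-t)`, an isometry with `J² = -1`, so that `C + S J` is unitary whenever `C² + S² = 1`.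
Follow it by the two-sided dilation by `α⁻²` on the left and `β⁻²` on the right. Away from `0` the
result `u` of a smooth `F` satisfies `-(p u')' = ` the image of `-F''`. At `0`, continuity of `u`
and continuity of the flux `p u'` both amount to `α (C + S) = β (C - S)`, which fixes the angle: `C`
and `S` are proportional to `α + β` and `β - α`.

Composing with the inverse Fourier transform gives a unitary `W` (`toyTransform`) that turns `A_p`
into multiplication by `(2πξ)²`. The inclusion of the multiplication operator in `A_p` is a
computation with weak derivatives. Equality follows because `1 + (2πξ)²` is onto while `A_p + 1` is
injective (`mem_sturmLiouville_graph_iff`). Since the spectral projection is defined through an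
arbitrary choice of spectral measure, uniqueness on closed bounded intervals is proved as well
(`proj_Icc_unique`). Hence the Paley–Wiener space is the `W`-image of the functions supported in
`|ξ| ≤ √Ω/(2π)`.

The kernel is the ordinary sinc kernel with the change of variables applied in both arguments
(`toyMap_toyMap_sinc`). At the points `x_j` all sinc arguments are integer multiples of `π`, which
gives orthogonality (`toyKernel_toyPoint`). For completeness, the values of `u` at `x_j` and
`x_{-j}` are, up to scalars, a rotation of the two values `F(±πj/√Ω)`, so vanishing samples force
all Fourier coefficients of the spectrum on the band to vanish (`eq_zero_of_samples`). Unconditional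
`L²` convergence is the basis expansion. Uniform convergence follows from it because the kernel
vectors are bounded in norm. -/

theorem scalarMeasure_apply (E : ProjValuedMeasure H) (f : H) {s : Set ℝ} (hs : MeasurableSet s) :
    E.scalarMeasure f s = ENNReal.ofReal (‖E.proj s f‖ ^ 2) :=
  Measure.ofMeasurable_apply s hs

theorem inner_proj_left (E : ProjValuedMeasure H) (s : Set ℝ) (x y : H) :
    inner ℂ (E.proj s x) y = inner ℂ x (E.proj s y) := by
  have h : ContinuousLinearMap.adjoint (E.proj s) = E.proj s := (E.isStarProjection s).isSelfAdjoint
  conv_lhs => rw [← h]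
  exact ContinuousLinearMap.adjoint_inner_left _ _ _

theorem proj_proj (E : ProjValuedMeasure H) {s t : Set ℝ} (hs : MeasurableSet s)
    (ht : MeasurableSet t) (x : H) : E.proj s (E.proj t x) = E.proj (s ∩ t) x := by
  rw [E.proj_inter s t hs ht]; rfl

theorem proj_comm (E : ProjValuedMeasure H) {s t : Set ℝ} (hs : MeasurableSet s)
    (ht : MeasurableSet t) (x : H) : E.proj s (E.proj t x) = E.proj t (E.proj s x) := by
  rw [E.proj_proj hs ht, E.proj_proj ht hs, inter_comm]

theorem proj_idem (E : ProjValuedMeasure H) (s : Set ℝ) (x : H) :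
    E.proj s (E.proj s x) = E.proj s x :=
  congrArg (fun T : H →L[ℂ] H => T x) (E.isStarProjection s).isIdempotentElem

theorem proj_empty (E : ProjValuedMeasure H) : E.proj ∅ = 0 := by
  ext f
  have h := E.hasSum_iUnion (fun _ => ∅) (fun _ => MeasurableSet.empty)
    (fun _ _ _ => disjoint_bot_left) f
  exact tendsto_nhds_unique tendsto_const_nhds h.summable.tendsto_atTop_zero

theorem proj_add_compl (E : ProjValuedMeasure H) {s : Set ℝ} (hs : MeasurableSet s) (x : H) :
    E.proj s x + E.proj sᶜ x = x := by
  have h := E.hasSum_iUnion (fun n => if n = 0 then s else if n = 1 then sᶜ else ∅)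
    (fun n => by split_ifs <;> simp [hs])
    (fun i j hij => by
      simp only [Function.onFun]
      split_ifs <;> first | omega | simp [disjoint_compl_right, disjoint_compl_left]) x
  have hU : (⋃ n : ℕ, (if n = 0 then s else if n = 1 then sᶜ else ∅)) = univ := by
    refine eq_univ_of_forall fun t => ?_
    by_cases ht : t ∈ s
    · exact mem_iUnion.2 ⟨0, by simpa using ht⟩
    · exact mem_iUnion.2 ⟨1, by simpa using ht⟩
  rw [hU, E.proj_univ] at h
  have h2 := hasSum_sum_of_ne_finset_zero (s := {0, 1}) (L := SummationFilter.unconditional ℕ)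
    (f := fun n : ℕ => E.proj (if n = 0 then s else if n = 1 then sᶜ else ∅) x) (by
      intro n hn
      simp only [Finset.mem_insert, Finset.mem_singleton, not_or] at hn
      simp [hn.1, hn.2, E.proj_empty])
  have := h2.unique h
  simpa using this

theorem norm_proj_le (E : ProjValuedMeasure H) (s : Set ℝ) (x : H) : ‖E.proj s x‖ ≤ ‖x‖ := by
  have h := E.inner_proj s x
  have h1 : ‖E.proj s x‖ ^ 2 ≤ ‖x‖ * ‖E.proj s x‖ := by
    have := norm_inner_le_norm (𝕜 := ℂ) x (E.proj s x)
    rwa [h, Complex.norm_real, Real.norm_of_nonneg (by positivity)] at this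
  by_contra! hlt
  nlinarith [norm_nonneg x, norm_nonneg (E.proj s x)]

instance (E : ProjValuedMeasure H) (f : H) : IsFiniteMeasure (E.scalarMeasure f) :=
  ⟨by rw [E.scalarMeasure_apply f MeasurableSet.univ]; exact ENNReal.ofReal_lt_top⟩

theorem scalarMeasure_proj (E : ProjValuedMeasure H) {s : Set ℝ} (hs : MeasurableSet s) (f : H) :
    E.scalarMeasure (E.proj s f) = (E.scalarMeasure f).restrict s := by
  ext t ht
  rw [Measure.restrict_apply ht, E.scalarMeasure_apply _ ht, E.scalarMeasure_apply _ (ht.inter hs),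
    E.proj_proj ht hs]

theorem scalarMeasure_univ (E : ProjValuedMeasure H) (f : H) :
    (E.scalarMeasure f).real univ = ‖f‖ ^ 2 := by
  rw [measureReal_def, E.scalarMeasure_apply f MeasurableSet.univ, E.proj_univ,
    ENNReal.toReal_ofReal (by positivity)]
  rfl

theorem inner_proj_compl (E : ProjValuedMeasure H) {s : Set ℝ} (hs : MeasurableSet s) (x y : H) :
    inner ℂ (E.proj s x) (E.proj sᶜ y) = 0 := by
  rw [E.inner_proj_left, E.proj_proj hs hs.compl, inter_compl_self, E.proj_empty]
  simp

theorem scalarMeasure_add (E : ProjValuedMeasure H) {s : Set ℝ} (hs : MeasurableSet s) {x y : H}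
    (hx : E.proj s x = x) (hy : E.proj sᶜ y = y) :
    E.scalarMeasure (x + y) = E.scalarMeasure x + E.scalarMeasure y := by
  ext t ht
  rw [Measure.add_apply, E.scalarMeasure_apply _ ht, E.scalarMeasure_apply _ ht,
    E.scalarMeasure_apply _ ht, ← ENNReal.ofReal_add (by positivity) (by positivity), map_add]
  congr 1
  have h0 : inner ℂ (E.proj t x) (E.proj t y) = 0 := by
    rw [← hx, ← hy, E.proj_comm ht hs, E.proj_comm ht hs.compl, E.inner_proj_compl hs]
  rw [sq, sq, sq]
  exact norm_add_sq_eq_norm_sq_add_norm_sq_of_inner_eq_zero _ _ h0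

end ProjValuedMeasure

/-- A symmetric-form bound: if `|⟨x, T x⟩| ≤ r ‖x‖²` for all `x` and the form is real, then
`‖T x‖ ≤ r ‖x‖`. -/
theorem norm_le_of_abs_inner_le {H : Type*} [NormedAddCommGroup H] [InnerProductSpace ℂ H]
    (T : H →ₗ[ℂ] H) (q : H → ℝ) (r : ℝ) (hT : ∀ x, inner ℂ x (T x) = (q x : ℂ))
    (hq : ∀ x, |q x| ≤ r * ‖x‖ ^ 2) (x : H) : ‖T x‖ ≤ r * ‖x‖ := by
  have hsymm : T.IsSymmetric := by
    rw [LinearMap.isSymmetric_iff_inner_map_self_real]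
    intro v
    rw [← inner_conj_symm, hT v, Complex.conj_ofReal, Complex.conj_ofReal]
  have key : ∀ u w : H, 4 * (inner ℂ (T u) w).re ≤ 2 * r * (‖u‖ ^ 2 + ‖w‖ ^ 2) := by
    intro u w
    have e1 : q (u + w) - q (u - w) = 4 * (inner ℂ (T u) w).re := by
      have h1 := congrArg Complex.re (hT (u + w))
      have h2 := congrArg Complex.re (hT (u - w))
      simp only [map_add, map_sub, inner_add_left, inner_add_right, inner_sub_left,
        inner_sub_right, Complex.add_re, Complex.sub_re, Complex.ofReal_re] at h1 h2
      have h3 : (inner ℂ u (T w)).re = (inner ℂ (T u) w).re := by rw [hsymm u w]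
      have h4 : (inner ℂ w (T u)).re = (inner ℂ (T u) w).re := by
        rw [← inner_conj_symm]; rfl
      linarith
    have p := parallelogram_law_with_norm ℂ u w
    have a1 := (abs_le.1 (hq (u + w))).2
    have a2 := (abs_le.1 (hq (u - w))).1
    have a3 : r * ‖u + w‖ ^ 2 + r * ‖u - w‖ ^ 2 = r * (2 * (‖u‖ ^ 2 + ‖w‖ ^ 2)) := by
      rw [← mul_add, p]
    linarith
  by_cases hx : x = 0
  · simp [hx]
  by_cases hTx : T x = 0
  · have h0 : |q x| ≤ r * ‖x‖ ^ 2 := hq x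
    have hr : 0 ≤ r := by
      have := (abs_nonneg _).trans h0
      have hpos : 0 < ‖x‖ ^ 2 := by have := norm_pos_iff.2 hx; positivity
      exact nonneg_of_mul_nonneg_left this hpos
    rw [hTx, norm_zero]; positivity
  have hx' := norm_pos_iff.2 hx
  have hT' := norm_pos_iff.2 hTx
  -- The scaling gives both vectors the norm `‖x‖ ‖T x‖`, which makes the polarized bound sharp.
  have := key ((‖T x‖ : ℂ) • x) ((‖x‖ : ℂ) • T x)
  rw [map_smul, inner_smul_left, inner_smul_right, inner_self_eq_norm_sq_to_K, norm_smul,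
    norm_smul] at this
  simp only [Complex.conj_ofReal, Complex.norm_real, norm_norm, Complex.coe_algebraMap] at this
  rw [← Complex.ofReal_pow, ← Complex.ofReal_mul, ← Complex.ofReal_mul, Complex.ofReal_re] at this
  have h2 : (‖T x‖ ^ 2 * ‖x‖) * ‖T x‖ ≤ (‖T x‖ ^ 2 * ‖x‖) * (r * ‖x‖) := by nlinarith
  exact le_of_mul_le_mul_left h2 (by positivity)

/-! ### Commutation with the spectral projections, and uniqueness on intervals. -/

namespace IsSpectralMeasure

variable {H : Type*} [NormedAddCommGroup H] [InnerProductSpace ℂ H] [CompleteSpace H]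
  {A : H →ₗ.[ℂ] H} {E F : ProjValuedMeasure H}

theorem inner_graph (hE : IsSpectralMeasure A E) {x x' : H} (h : (x, x') ∈ A.graph) :
    inner ℂ x x' = ((∫ t, t ∂(E.scalarMeasure x) : ℝ) : ℂ) := by
  obtain ⟨y, hy, hy'⟩ := (LinearPMap.mem_graph_iff A).1 h
  have := hE.inner_apply y
  simp only at hy hy'
  rwa [hy, hy'] at this

theorem mem_domain (hE : IsSpectralMeasure A E) {x x' : H} (h : (x, x') ∈ A.graph) :
    ∫⁻ t, ENNReal.ofReal (t ^ 2) ∂(E.scalarMeasure x) < ∞ :=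
  (hE.mem_domain_iff x).1 (LinearPMap.mem_domain_of_mem_graph h)

theorem exists_graph (hE : IsSpectralMeasure A E) {x : H}
    (h : ∫⁻ t, ENNReal.ofReal (t ^ 2) ∂(E.scalarMeasure x) < ∞) : ∃ x', (x, x') ∈ A.graph :=
  ⟨A ⟨x, (hE.mem_domain_iff x).2 h⟩, A.mem_graph ⟨x, (hE.mem_domain_iff x).2 h⟩⟩

theorem integrable_id (hE : IsSpectralMeasure A E) {x x' : H} (h : (x, x') ∈ A.graph) :
    Integrable (fun t : ℝ => t) (E.scalarMeasure x) := by
  have h2 : MemLp (fun t : ℝ => t) 2 (E.scalarMeasure x) := by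
    refine (memLp_two_iff_integrable_sq measurable_id.aestronglyMeasurable).2 ?_
    refine ⟨(measurable_id.pow_const 2).aestronglyMeasurable, ?_⟩
    rw [hasFiniteIntegral_iff_ofReal (Eventually.of_forall fun t => by positivity)]
    exact hE.mem_domain h
  exact h2.integrable (by norm_num)

theorem exists_graph_proj (hE : IsSpectralMeasure A E) {s : Set ℝ} (hs : MeasurableSet s)
    {x x' : H} (h : (x, x') ∈ A.graph) : ∃ y, (E.proj s x, y) ∈ A.graph := by
  refine hE.exists_graph ?_
  rw [E.scalarMeasure_proj hs]
  exact (lintegral_mono' Measure.restrict_le_self le_rfl).trans_lt (hE.mem_domain h)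

theorem exists_graph_bounded (hE : IsSpectralMeasure A E) {s : Set ℝ} (hs : MeasurableSet s)
    {a b : ℝ} (hsub : s ⊆ Icc a b) (x : H) : ∃ y, (E.proj s x, y) ∈ A.graph := by
  refine hE.exists_graph ?_
  rw [E.scalarMeasure_proj hs]
  have : ∀ t ∈ s, ENNReal.ofReal (t ^ 2) ≤ ENNReal.ofReal ((max |a| |b|) ^ 2) := by
    intro t ht
    refine ENNReal.ofReal_le_ofReal (sq_le_sq' ?_ ?_)
    · have := (hsub ht).1
      linarith [le_max_left |a| |b|, neg_abs_le a]
    · have := (hsub ht).2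
      linarith [le_max_right |a| |b|, le_abs_self b]
  refine (setLIntegral_mono measurable_const this).trans_lt ?_
  rw [setLIntegral_const]
  exact ENNReal.mul_lt_top ENNReal.ofReal_lt_top (measure_lt_top _ _)

/-- Since the scalar measure of `x + y` is the sum of those of `x` and `y`, the quadratic form is
additive and the cross terms satisfy `⟨x, y'⟩ + ⟨y, x'⟩ = 0`. Replacing `y` by `i y` gives `⟨x, y'⟩
- ⟨y, x'⟩ = 0`, so each vanishes. This recovers off-diagonal information from a definition that only
prescribes the quadratic form. -/
theorem inner_compl_eq_zero (hE : IsSpectralMeasure A E) {s : Set ℝ} (hs : MeasurableSet s)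
    {x x' y y' : H} (hx : (x, x') ∈ A.graph) (hy : (y, y') ∈ A.graph)
    (hxs : E.proj s x = x) (hys : E.proj sᶜ y = y) : inner ℂ x y' = 0 := by
  have key : ∀ {y y' : H}, (y, y') ∈ A.graph → E.proj sᶜ y = y →
      inner ℂ x y' + inner ℂ y x' = 0 := by
    intro y y' hy hys
    have h1 := hE.inner_graph (A.graph.add_mem hx hy)
    have h2 := hE.inner_graph hx
    have h3 := hE.inner_graph hy
    simp only [inner_add_left, inner_add_right] at h1
    rw [E.scalarMeasure_add hs hxs hys,
      integral_add_measure (hE.integrable_id hx) (hE.integrable_id hy), Complex.ofReal_add,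
      ← h2, ← h3] at h1
    linear_combination h1
  have k1 := key hy hys
  have k2 := key (A.graph.smul_mem Complex.I hy) (by rw [map_smul, hys])
  rw [inner_smul_right, inner_smul_left, Complex.conj_I] at k2
  have : Complex.I * (2 * inner ℂ x y') = 0 := by linear_combination k2 + Complex.I * k1
  simpa using this

theorem tendsto_proj_Icc (E : ProjValuedMeasure H) (x : H) :
    Tendsto (fun n : ℕ => E.proj (Icc (-(n : ℝ)) n) x) atTop (𝓝 x) := by
  have hmono : Monotone fun n : ℕ => Icc (-(n : ℝ)) n := by
    intro m n hmn
    have : (m : ℝ) ≤ n := by exact_mod_cast hmn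
    exact Icc_subset_Icc (by linarith) this
  have hU : (⋃ n : ℕ, Icc (-(n : ℝ)) n) = univ := by
    refine eq_univ_of_forall fun t => ?_
    obtain ⟨n, hn⟩ := exists_nat_ge |t|
    exact mem_iUnion.2 ⟨n, abs_le.1 hn⟩
  have h1 : Tendsto (fun n : ℕ => E.scalarMeasure x (Icc (-(n : ℝ)) n)ᶜ) atTop (𝓝 0) := by
    have := tendsto_measure_iInter_atTop (μ := E.scalarMeasure x)
      (s := fun n : ℕ => (Icc (-(n : ℝ)) n)ᶜ)
      (fun n => measurableSet_Icc.compl.nullMeasurableSet)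
      (fun m n hmn => compl_subset_compl.2 (hmono hmn)) ⟨0, measure_ne_top _ _⟩
    rwa [← compl_iUnion, hU, compl_univ, measure_empty] at this
  rw [tendsto_iff_norm_sub_tendsto_zero]
  have h2 : Tendsto (fun n : ℕ => ‖E.proj (Icc (-(n : ℝ)) n)ᶜ x‖ ^ 2) atTop (𝓝 0) := by
    have := (ENNReal.tendsto_toReal ENNReal.zero_ne_top).comp h1
    simp only [Function.comp_def, ENNReal.toReal_zero] at this
    refine this.congr fun n => ?_
    rw [E.scalarMeasure_apply _ measurableSet_Icc.compl, ENNReal.toReal_ofReal (by positivity)]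
  have h3 := h2.sqrt
  rw [Real.sqrt_zero] at h3
  refine h3.congr fun n => ?_
  rw [Real.sqrt_sq (norm_nonneg _), norm_sub_rev]
  congr 1
  exact eq_sub_of_add_eq' (E.proj_add_compl measurableSet_Icc x)

/-- `A` maps the range of `E s` into itself. -/
theorem proj_eq_self_of_graph (hE : IsSpectralMeasure A E) {s : Set ℝ} (hs : MeasurableSet s)
    {y y' : H} (hy : (y, y') ∈ A.graph) (hys : E.proj s y = y) : E.proj s y' = y' := by
  have h0 : E.proj sᶜ y' = 0 := by
    have hz : ∀ z, inner ℂ z (E.proj sᶜ y') = 0 := by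
      intro z
      -- A general `z` need not lie in the domain; its truncation to the spectral window `[-n, n]`
      -- does, and the truncations converge to `z`.
      have hn : ∀ n : ℕ, inner ℂ (E.proj (Icc (-(n : ℝ)) n) z) (E.proj sᶜ y') = 0 := by
        intro n
        obtain ⟨w, hw⟩ := hE.exists_graph_bounded (measurableSet_Icc.inter hs.compl)
          (inter_subset_left (s := Icc (-(n : ℝ)) n) (t := sᶜ)) z
        rw [← E.inner_proj_left, E.proj_comm hs.compl measurableSet_Icc,
          E.proj_proj measurableSet_Icc hs.compl]
        refine hE.inner_compl_eq_zero hs.compl hw hy ?_ (by rwa [compl_compl])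
        rw [E.proj_proj hs.compl (measurableSet_Icc.inter hs.compl), inter_comm, inter_assoc,
          inter_self]
      have ht := (tendsto_proj_Icc E z).inner (𝕜 := ℂ) (tendsto_const_nhds (x := E.proj sᶜ y'))
      simp only [hn] at ht
      exact tendsto_nhds_unique ht tendsto_const_nhds
    exact inner_self_eq_zero.1 (hz _)
  have := E.proj_add_compl hs y'
  rwa [h0, add_zero] at this

/-- `A` commutes with its spectral projections. -/
theorem proj_graph (hE : IsSpectralMeasure A E) {s : Set ℝ} (hs : MeasurableSet s)
    {x x' : H} (hx : (x, x') ∈ A.graph) : (E.proj s x, E.proj s x') ∈ A.graph := by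
  obtain ⟨y, hy⟩ := hE.exists_graph_proj hs hx
  have h1 := hE.proj_eq_self_of_graph hs hy (E.proj_idem s x)
  have hz : (E.proj sᶜ x, x' - y) ∈ A.graph := by
    have := A.graph.sub_mem hx hy
    have e : x - E.proj s x = E.proj sᶜ x := by
      rw [sub_eq_iff_eq_add', E.proj_add_compl hs]
    simpa [e] using this
  have h2 := hE.proj_eq_self_of_graph hs.compl hz (E.proj_idem _ x)
  have h3 : E.proj s (x' - y) = 0 := by
    rw [← h2, E.proj_proj hs hs.compl, inter_compl_self, E.proj_empty]; rfl
  rw [map_sub, h1, sub_eq_zero] at h3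
  rwa [h3]

theorem inner_sub_smul (hE : IsSpectralMeasure A E) {x x' : H} (hx : (x, x') ∈ A.graph) (c : ℝ) :
    inner ℂ x (x' - (c : ℂ) • x) = ((∫ t, (t - c) ∂(E.scalarMeasure x) : ℝ) : ℂ) := by
  rw [inner_sub_right, hE.inner_graph hx, inner_smul_right, inner_self_eq_norm_sq_to_K,
    integral_sub (hE.integrable_id hx) (integrable_const _), integral_const, E.scalarMeasure_univ]
  push_cast
  simp [mul_comm]

theorem scalarMeasure_ae_mem (E : ProjValuedMeasure H) {s : Set ℝ} (hs : MeasurableSet s) {x : H}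
    (hx : E.proj s x = x) : ∀ᵐ t ∂(E.scalarMeasure x), t ∈ s := by
  rw [← hx, E.scalarMeasure_proj hs]
  exact ae_restrict_mem hs

/-- On the range of `E(I)` with `I = [c - r, c + r]` the form of `A - c` is bounded by `r`.
Extending it to the everywhere defined operator `T = (A - c) E(I)` turns the form bound into a norm
bound by symmetry. -/
theorem norm_sub_smul_le (hE : IsSpectralMeasure A E) {c r : ℝ} (hr : 0 ≤ r)
    {x x' : H} (hx : (x, x') ∈ A.graph) (hxs : E.proj (Icc (c - r) (c + r)) x = x) :
    ‖x' - (c : ℂ) • x‖ ≤ r * ‖x‖ := by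
  set I := Icc (c - r) (c + r) with hI
  have hIm : MeasurableSet I := measurableSet_Icc
  choose B hB using fun z => hE.exists_graph_bounded hIm (subset_refl I) z
  let T : H →ₗ[ℂ] H :=
    { toFun := fun z => B z - (c : ℂ) • E.proj I z
      map_add' := fun z w => by
        have h := A.graph.add_mem (hB z) (hB w)
        have h2 := hB (z + w)
        rw [map_add] at h2
        rw [A.mem_graph_snd_inj h2 h rfl, map_add]
        simp only [smul_add]
        abel
      map_smul' := fun a z => by
        have h := A.graph.smul_mem a (hB z)
        have h2 := hB (a • z)
        rw [map_smul] at h2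
        rw [A.mem_graph_snd_inj h2 h rfl, map_smul, RingHom.id_apply, smul_sub, smul_comm a] }
  have hTx : T x = x' - (c : ℂ) • x := by
    have h2 := hB x
    rw [hxs] at h2
    change B x - (c : ℂ) • E.proj I x = _
    rw [A.mem_graph_snd_inj h2 hx rfl, hxs]
  rw [← hTx]
  refine norm_le_of_abs_inner_le T (fun z => ∫ t, (t - c) ∂(E.scalarMeasure (E.proj I z))) r
    (fun z => ?_) (fun z => ?_) x
  · rw [← hE.inner_sub_smul (hB z) c, E.inner_proj_left, map_sub, map_smul, E.proj_idem,
      hE.proj_eq_self_of_graph hIm (hB z) (E.proj_idem I z)]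
    rfl
  · have h1 : ∀ᵐ t ∂(E.scalarMeasure (E.proj I z)), ‖t - c‖ ≤ r := by
      filter_upwards [scalarMeasure_ae_mem E hIm (E.proj_idem I z)] with t ht
      rw [Real.norm_eq_abs, abs_le]
      constructor <;> linarith [ht.1, ht.2]
    have h2 := norm_integral_le_of_norm_le_const h1
    rw [E.scalarMeasure_univ, Real.norm_eq_abs] at h2
    refine h2.trans ?_
    gcongr
    exact E.norm_proj_le I z

/-- Because `s` lies on one side of `c`, the integrand `t - c` has constant sign and modulus at
least `|γ - c|` on `s`; Cauchy–Schwarz then gives the lower bound without any functional calculus.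
-/
theorem le_norm_sub_smul (hF : IsSpectralMeasure A F) {c γ : ℝ} {s : Set ℝ} (hs : MeasurableSet s)
    (hsub : s ⊆ Ici γ ∧ c ≤ γ ∨ s ⊆ Iic γ ∧ γ ≤ c) {x x' : H} (hx : (x, x') ∈ A.graph)
    (hxs : F.proj s x = x) : |γ - c| * ‖x‖ ≤ ‖x' - (c : ℂ) • x‖ := by
  have h1 := norm_inner_le_norm (𝕜 := ℂ) x (x' - (c : ℂ) • x)
  rw [hF.inner_sub_smul hx, Complex.norm_real, Real.norm_eq_abs] at h1
  have hint : Integrable (fun t : ℝ => t - c) (F.scalarMeasure x) :=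
    (hF.integrable_id hx).sub (integrable_const c)
  have h2 : |γ - c| * ‖x‖ ^ 2 ≤ |∫ t, (t - c) ∂(F.scalarMeasure x)| := by
    have hconst : ∫ _, (γ - c) ∂(F.scalarMeasure x) = (γ - c) * ‖x‖ ^ 2 := by
      rw [integral_const, F.scalarMeasure_univ, smul_eq_mul, mul_comm]
    have hae := scalarMeasure_ae_mem F hs hxs
    rcases hsub with ⟨h, hc⟩ | ⟨h, hc⟩
    · have := integral_mono_ae (integrable_const (γ - c)) hint (by
        filter_upwards [hae] with t ht
        have : γ ≤ t := h ht
        simpa using this)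
      rw [hconst] at this
      rw [abs_of_nonneg (by linarith)]
      exact this.trans (le_abs_self _)
    · have := integral_mono_ae hint (integrable_const (γ - c)) (by
        filter_upwards [hae] with t ht
        have : t ≤ γ := h ht
        simpa using this)
      rw [hconst] at this
      rw [abs_of_nonpos (by linarith)]
      exact le_trans (by linarith) (neg_le_abs _)
  by_cases h0 : ‖x‖ = 0
  · rw [h0]; simp
  · have hpos : 0 < ‖x‖ := lt_of_le_of_ne (norm_nonneg x) (Ne.symm h0)
    refine le_of_mul_le_mul_left ?_ hpos
    nlinarith

/-- Spectral projections of separated sets, taken from two spectral measures of the same operator,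
are orthogonal. -/
theorem proj_proj_eq_zero (hE : IsSpectralMeasure A E) (hF : IsSpectralMeasure A F)
    {c r γ : ℝ} (hr : 0 ≤ r) (hγ : r < |γ - c|) {s : Set ℝ} (hs : MeasurableSet s)
    (hsub : s ⊆ Ici γ ∧ c ≤ γ ∨ s ⊆ Iic γ ∧ γ ≤ c) (x : H) :
    F.proj s (E.proj (Icc (c - r) (c + r)) x) = 0 := by
  set I := Icc (c - r) (c + r) with hI
  have hIm : MeasurableSet I := measurableSet_Icc
  set X : H →L[ℂ] H := F.proj s * E.proj I with hX
  have hδ : 0 < |γ - c| := hr.trans_lt hγ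
  -- `X = F(s) E(I)` intertwines `A - c` with itself: the operator is at most `r` on the range of
  -- `E(I)` and at least `|γ - c|` on the range of `F(s)`. The resulting bound `‖X‖ ≤ ‖X‖ r / |γ -
  -- c|` with `r < |γ - c|` forces `X = 0`.
  have key : ∀ z, ‖X z‖ ≤ (‖X‖ * r / |γ - c|) * ‖z‖ := by
    intro z
    obtain ⟨y, hy⟩ := hE.exists_graph_bounded hIm (subset_refl I) z
    have hyI := hE.proj_eq_self_of_graph hIm hy (E.proj_idem I z)
    have h1 := hF.le_norm_sub_smul hs hsub (hF.proj_graph hs hy) (F.proj_idem s _)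
    have h2 := hE.norm_sub_smul_le hr hy (E.proj_idem I z)
    have h3 : F.proj s y - (c : ℂ) • F.proj s (E.proj I z) = X (y - (c : ℂ) • E.proj I z) := by
      change _ = F.proj s (E.proj I (y - (c : ℂ) • E.proj I z))
      rw [map_sub, map_smul, hyI, E.proj_idem, map_sub, map_smul]
    rw [h3] at h1
    have h4 : |γ - c| * ‖X z‖ ≤ ‖X‖ * (r * ‖z‖) :=
      h1.trans ((X.le_opNorm _).trans (by
        gcongr
        exact h2.trans (by gcongr; exact E.norm_proj_le I z)))
    rw [div_mul_eq_mul_div, le_div_iff₀ hδ]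
    linarith
  have h5 := X.opNorm_le_bound (by positivity) key
  have h6 : ‖X‖ = 0 := by
    rw [le_div_iff₀ hδ] at h5
    by_contra hne
    have hpos : 0 < ‖X‖ := lt_of_le_of_ne (norm_nonneg X) (Ne.symm hne)
    have := le_of_mul_le_mul_left h5 hpos
    linarith
  have h7 : X = 0 := by simpa using h6
  exact congrArg (fun T : H →L[ℂ] H => T x) h7

/-- The complement of `[a, b]` is a countable union of half-lines at positive distance from it, and
`F` of each of them annihilates the range of `E([a, b])`. -/
theorem proj_Icc_proj_Icc (hE : IsSpectralMeasure A E) (hF : IsSpectralMeasure A F) {a b : ℝ}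
    (hab : a ≤ b) (x : H) : F.proj (Icc a b) (E.proj (Icc a b) x) = E.proj (Icc a b) x := by
  set y := E.proj (Icc a b) x with hy
  have hI : Icc a b = Icc ((a + b) / 2 - (b - a) / 2) ((a + b) / 2 + (b - a) / 2) := by
    congr 1 <;> ring
  have h0 : F.scalarMeasure y (Icc a b)ᶜ = 0 := by
    have hsub : (Icc a b)ᶜ ⊆ ⋃ n : ℕ, (Iic (a - 1 / ((n : ℝ) + 1)) ∪ Ici (b + 1 / ((n : ℝ) + 1))) := by
      intro t ht
      simp only [mem_compl_iff, mem_Icc, not_and_or, not_le] at ht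
      rcases ht with ht | ht
      · obtain ⟨n, hn⟩ := exists_nat_one_div_lt (sub_pos.2 ht)
        exact mem_iUnion.2 ⟨n, Or.inl (by simp only [mem_Iic]; linarith)⟩
      · obtain ⟨n, hn⟩ := exists_nat_one_div_lt (sub_pos.2 ht)
        exact mem_iUnion.2 ⟨n, Or.inr (by simp only [mem_Ici]; linarith)⟩
    refine measure_mono_null hsub (measure_iUnion_null fun n => measure_union_null ?_ ?_)
    · have hn : (0 : ℝ) < 1 / ((n : ℝ) + 1) := by positivity
      rw [F.scalarMeasure_apply _ measurableSet_Iic, hy, hI,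
        hE.proj_proj_eq_zero hF (by linarith) ?_ measurableSet_Iic
          (Or.inr ⟨subset_refl _, by linarith⟩)]
      · simp
      · rw [abs_of_nonpos (by linarith)]; linarith
    · have hn : (0 : ℝ) < 1 / ((n : ℝ) + 1) := by positivity
      rw [F.scalarMeasure_apply _ measurableSet_Ici, hy, hI,
        hE.proj_proj_eq_zero hF (by linarith) ?_ measurableSet_Ici
          (Or.inl ⟨subset_refl _, by linarith⟩)]
      · simp
      · rw [abs_of_nonneg (by linarith)]; linarith
  rw [F.scalarMeasure_apply _ measurableSet_Icc.compl, ENNReal.ofReal_eq_zero] at h0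
  have h1 : ‖F.proj (Icc a b)ᶜ y‖ = 0 := by
    have := sq_nonneg ‖F.proj (Icc a b)ᶜ y‖
    exact pow_eq_zero_iff two_ne_zero |>.1 (le_antisymm h0 this)
  have h2 := F.proj_add_compl (measurableSet_Icc (a := a) (b := b)) y
  rwa [norm_eq_zero.1 h1, add_zero] at h2

/-- Two spectral measures of the same operator agree on closed bounded intervals. -/
theorem proj_Icc_unique (hE : IsSpectralMeasure A E) (hF : IsSpectralMeasure A F) {a b : ℝ}
    (hab : a ≤ b) : E.proj (Icc a b) = F.proj (Icc a b) := by
  ext x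
  -- The two range inclusions `F E = E` and `E F = F` are combined by moving the self-adjoint
  -- projections across the inner product.
  rw [← hE.proj_Icc_proj_Icc hF hab x]
  refine ext_inner_left ℂ fun z => ?_
  rw [← F.inner_proj_left, ← E.inner_proj_left, hF.proj_Icc_proj_Icc hE hab, F.inner_proj_left]

/-- Makes the choice inside `spectralProjection` harmless: any explicit spectral measure computes it
on closed bounded intervals. -/
theorem spectralProjection_Icc (hE : IsSpectralMeasure A E) {a b : ℝ} (hab : a ≤ b) :
    spectralProjection A (Icc a b) = E.proj (Icc a b) := by
  have h : ∃ E : ProjValuedMeasure H, IsSpectralMeasure A E := ⟨E, hE⟩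
  rw [spectralProjection, dif_pos h]
  exact h.choose_spec.proj_Icc_unique hE hab

end IsSpectralMeasure

/-! ### Multiplication operators and their spectral measures -/

section Multiplication

variable {X : Type*} [MeasurableSpace X] {μ : Measure X}

/-- Multiplication by the indicator function of a measurable set on `L²(μ)`. -/
noncomputable def indicatorCLM (μ : Measure X) {S : Set X} (hS : MeasurableSet S) :
    Lp ℂ 2 μ →L[ℂ] Lp ℂ 2 μ :=
  LinearMap.mkContinuous
    { toFun := fun f => ((Lp.memLp f).indicator hS).toLp _
      map_add' := fun f g => by
        refine Lp.ext ?_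
        filter_upwards [((Lp.memLp (f + g)).indicator hS).coeFn_toLp,
          ((Lp.memLp f).indicator hS).coeFn_toLp, ((Lp.memLp g).indicator hS).coeFn_toLp,
          Lp.coeFn_add f g, Lp.coeFn_add (((Lp.memLp f).indicator hS).toLp _)
            (((Lp.memLp g).indicator hS).toLp _)] with x h1 h2 h3 h4 h5
        rw [h1, h5, Pi.add_apply, h2, h3]
        by_cases hx : x ∈ S
        · simp only [indicator_of_mem hx]
          exact h4
        · simp [hx]
      map_smul' := fun c f => by
        refine Lp.ext ?_
        filter_upwards [((Lp.memLp (c • f)).indicator hS).coeFn_toLp,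
          ((Lp.memLp f).indicator hS).coeFn_toLp, Lp.coeFn_smul c f,
          Lp.coeFn_smul c (((Lp.memLp f).indicator hS).toLp _)] with x h1 h2 h4 h5
        rw [h1, RingHom.id_apply, h5, Pi.smul_apply, h2]
        by_cases hx : x ∈ S <;> simp [hx, h4] } 1
    (fun f => by
      rw [one_mul]
      refine Lp.norm_le_norm_of_ae_le ?_
      filter_upwards [((Lp.memLp f).indicator hS).coeFn_toLp] with x hx
      simp only [LinearMap.coe_mk, AddHom.coe_mk]
      rw [hx]
      exact norm_indicator_le_norm_self _ _)

theorem coeFn_indicatorCLM {S : Set X} (hS : MeasurableSet S) (f : Lp ℂ 2 μ) :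
    indicatorCLM μ hS f =ᵐ[μ] S.indicator f :=
  ((Lp.memLp f).indicator hS).coeFn_toLp

theorem indicatorCLM_univ (f : Lp ℂ 2 μ) : indicatorCLM μ MeasurableSet.univ f = f := by
  refine Lp.ext ((coeFn_indicatorCLM _ f).trans ?_)
  rw [indicator_univ]

theorem indicatorCLM_indicatorCLM {S T : Set X} (hS : MeasurableSet S) (hT : MeasurableSet T)
    (f : Lp ℂ 2 μ) :
    indicatorCLM μ hS (indicatorCLM μ hT f) = indicatorCLM μ (hS.inter hT) f := by
  refine Lp.ext ?_
  filter_upwards [coeFn_indicatorCLM hS (indicatorCLM μ hT f), coeFn_indicatorCLM hT f,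
    coeFn_indicatorCLM (hS.inter hT) f] with x h1 h2 h3
  rw [h1, h3, ← indicator_indicator]
  by_cases hx : x ∈ S <;> simp [hx, h2]

theorem inner_indicatorCLM {S : Set X} (hS : MeasurableSet S) (f g : Lp ℂ 2 μ) :
    inner ℂ (indicatorCLM μ hS f) g = inner ℂ f (indicatorCLM μ hS g) := by
  rw [L2.inner_def, L2.inner_def]
  refine integral_congr_ae ?_
  filter_upwards [coeFn_indicatorCLM hS f, coeFn_indicatorCLM hS g] with x h1 h2
  rw [h1, h2]
  by_cases hx : x ∈ S <;> simp [hx]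

theorem norm_sq_Lp_two (f : Lp ℂ 2 μ) : ‖f‖ ^ 2 = ∫ x, ‖f x‖ ^ 2 ∂μ := by
  have h : (inner ℂ f f : ℂ) = ∫ x, (inner ℂ (f x) (f x) : ℂ) ∂μ := L2.inner_def f f
  simp only [inner_self_eq_norm_sq_to_K] at h
  have h2 : ((‖f‖ ^ 2 : ℝ) : ℂ) = ((∫ x, ‖f x‖ ^ 2 ∂μ : ℝ) : ℂ) := by
    rw [← integral_complex_ofReal]
    push_cast
    exact h
  exact_mod_cast h2

theorem integrable_norm_sq_Lp_two (f : Lp ℂ 2 μ) : Integrable (fun x => ‖f x‖ ^ 2) μ :=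
  (Lp.memLp f).integrable_norm_pow two_ne_zero

theorem norm_sq_indicatorCLM {S : Set X} (hS : MeasurableSet S) (f : Lp ℂ 2 μ) :
    ‖indicatorCLM μ hS f‖ ^ 2 = ∫ x in S, ‖f x‖ ^ 2 ∂μ := by
  rw [norm_sq_Lp_two, ← integral_indicator hS]
  refine integral_congr_ae ?_
  filter_upwards [coeFn_indicatorCLM hS f] with x h1
  rw [h1]
  by_cases hx : x ∈ S <;> simp [hx]

/-- The squared distance from a partial sum to the limit is the mass of `‖f‖²` on the sets not yet
used, so strong countable additivity reduces to countable additivity of an integral. -/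
theorem hasSum_indicatorCLM {S : ℕ → Set X} (hS : ∀ n, MeasurableSet (S n))
    (hd : Pairwise (Function.onFun Disjoint S)) (f : Lp ℂ 2 μ) :
    HasSum (fun n => indicatorCLM μ (hS n) f) (indicatorCLM μ (MeasurableSet.iUnion hS) f) := by
  have hsum : ∀ t : Finset ℕ, ∑ n ∈ t, indicatorCLM μ (hS n) f =
      indicatorCLM μ (t.measurableSet_biUnion fun n _ => hS n) f := by
    intro t
    refine Lp.ext ?_
    have h1 : ∀ᵐ x ∂μ, ∀ n, indicatorCLM μ (hS n) f x = (S n).indicator f x :=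
      ae_all_iff.2 fun n => coeFn_indicatorCLM (hS n) f
    filter_upwards [h1, Lp.coeFn_finsetSum t (fun n => indicatorCLM μ (hS n) f),
      coeFn_indicatorCLM (t.measurableSet_biUnion fun n _ => hS n) f] with x h1 h2 h3
    rw [h2, h3, Finset.sum_apply, Finset.indicator_biUnion_apply]
    · exact Finset.sum_congr rfl fun n _ => h1 n
    · exact fun i _ j _ hij => hd hij
  have hdiff : ∀ t : Finset ℕ, ‖∑ n ∈ t, indicatorCLM μ (hS n) f -
      indicatorCLM μ (MeasurableSet.iUnion hS) f‖ ^ 2 =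
      ∫ x in ⋃ n, S n, ‖f x‖ ^ 2 ∂μ - ∑ n ∈ t, ∫ x in S n, ‖f x‖ ^ 2 ∂μ := by
    intro t
    have hB := t.measurableSet_biUnion fun n _ => hS n
    have hsub : (⋃ n ∈ t, S n) ⊆ ⋃ n, S n := iUnion₂_subset fun n _ => subset_iUnion S n
    rw [hsum, norm_sub_rev, ← integral_biUnion_finset t (fun n _ => hS n)
      (fun i _ j _ hij => hd hij) (fun n _ => (integrable_norm_sq_Lp_two f).integrableOn),
      ← setIntegral_sdiff hB (integrable_norm_sq_Lp_two f).integrableOn hsub,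
      ← norm_sq_indicatorCLM ((MeasurableSet.iUnion hS).diff hB)]
    congr 2
    refine Lp.ext ?_
    filter_upwards [coeFn_indicatorCLM hB f, coeFn_indicatorCLM (MeasurableSet.iUnion hS) f,
      coeFn_indicatorCLM ((MeasurableSet.iUnion hS).diff hB) f,
      Lp.coeFn_sub (indicatorCLM μ (MeasurableSet.iUnion hS) f) (indicatorCLM μ hB f)]
      with x h1 h2 h3 h4
    rw [h4, h3, Pi.sub_apply, h1, h2, indicator_sdiff hsub, Pi.sub_apply]
  have h := hasSum_integral_iUnion hS hd (integrable_norm_sq_Lp_two f).integrableOn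
  have h2 : Tendsto (fun t : Finset ℕ => ‖∑ n ∈ t, indicatorCLM μ (hS n) f -
      indicatorCLM μ (MeasurableSet.iUnion hS) f‖ ^ 2) atTop (𝓝 0) := by
    simp only [hdiff]
    have := (tendsto_const_nhds (x := ∫ x in ⋃ n, S n, ‖f x‖ ^ 2 ∂μ)).sub h
    rwa [sub_self] at this
  refine tendsto_iff_norm_sub_tendsto_zero.2 ?_
  have h3 := h2.sqrt
  rw [Real.sqrt_zero] at h3
  exact h3.congr fun t => Real.sqrt_sq (norm_nonneg _)

variable {H : Type*} [NormedAddCommGroup H] [InnerProductSpace ℂ H] [CompleteSpace H]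

open Classical in
/-- The spectral measure of the operator unitarily equivalent to multiplication by `m`. -/
noncomputable def multiplicationPVM (W : Lp ℂ 2 μ ≃ₗᵢ[ℂ] H) {m : X → ℝ} (hm : Measurable m) :
    ProjValuedMeasure H where
  proj s := if hs : MeasurableSet s then
    (W.toContinuousLinearEquiv : Lp ℂ 2 μ →L[ℂ] H) ∘L indicatorCLM μ (hm hs) ∘L
      (W.symm.toContinuousLinearEquiv : H →L[ℂ] Lp ℂ 2 μ) else 0
  isStarProjection s := by
    split_ifs with hs
    · refine ⟨?_, ?_⟩
      · ext x
        simp [indicatorCLM_indicatorCLM]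
      · rw [ContinuousLinearMap.isSelfAdjoint_iff_isSymmetric]
        intro x y
        have h := inner_indicatorCLM (hm hs) (W.symm x) (W.symm y)
        rw [← W.inner_map_map, ← W.inner_map_map] at h
        simpa using h
    · exact IsStarProjection.zero _
  not_measurable s hs := dif_neg hs
  proj_univ := by
    rw [dif_pos MeasurableSet.univ]
    ext x
    have := indicatorCLM_univ (W.symm x)
    simp only [ContinuousLinearMap.comp_apply]
    change W (indicatorCLM μ MeasurableSet.univ (W.symm x)) = x
    rw [this, W.apply_symm_apply]
  proj_inter s t hs ht := by
    rw [dif_pos hs, dif_pos ht, dif_pos (hs.inter ht)]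
    ext x
    simp [indicatorCLM_indicatorCLM]
  hasSum_iUnion s hs hd f := by
    simp only [hs, dif_pos, MeasurableSet.iUnion hs]
    have h := hasSum_indicatorCLM (μ := μ) (fun n => hm (hs n))
      (fun i j hij => (hd hij).preimage m) (W.symm f)
    have h2 := (W.toContinuousLinearEquiv : Lp ℂ 2 μ →L[ℂ] H).hasSum h
    simp only [preimage_iUnion]
    exact h2

theorem multiplicationPVM_proj (W : Lp ℂ 2 μ ≃ₗᵢ[ℂ] H) {m : X → ℝ} (hm : Measurable m)
    {s : Set ℝ} (hs : MeasurableSet s) (φ : Lp ℂ 2 μ) :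
    (multiplicationPVM W hm).proj s (W φ) = W (indicatorCLM μ (hm hs) φ) := by
  have : (multiplicationPVM W hm).proj s = (W.toContinuousLinearEquiv : Lp ℂ 2 μ →L[ℂ] H) ∘L
      indicatorCLM μ (hm hs) ∘L (W.symm.toContinuousLinearEquiv : H →L[ℂ] Lp ℂ 2 μ) := dif_pos hs
  rw [this]
  simp

theorem scalarMeasure_multiplicationPVM (W : Lp ℂ 2 μ ≃ₗᵢ[ℂ] H) {m : X → ℝ} (hm : Measurable m)
    (φ : Lp ℂ 2 μ) : (multiplicationPVM W hm).scalarMeasure (W φ) =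
      (μ.withDensity fun x => ENNReal.ofReal (‖φ x‖ ^ 2)).map m := by
  ext s hs
  rw [ProjValuedMeasure.scalarMeasure_apply _ _ hs, multiplicationPVM_proj W hm hs,
    Measure.map_apply hm hs, withDensity_apply _ (hm hs), W.norm_map, norm_sq_indicatorCLM,
    ofReal_integral_eq_lintegral_ofReal (integrable_norm_sq_Lp_two φ).integrableOn
      (Eventually.of_forall fun x => by positivity)]

/-- An operator that is unitarily equivalent to multiplication by the real function `m` has the
corresponding spectral measure. -/
theorem isSpectralMeasure_multiplicationPVM (W : Lp ℂ 2 μ ≃ₗᵢ[ℂ] H) {m : X → ℝ}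
    (hm : Measurable m) {A : H →ₗ.[ℂ] H}
    (hA : ∀ φ ψ : Lp ℂ 2 μ, (W φ, W ψ) ∈ A.graph ↔ ψ =ᵐ[μ] fun x => (m x : ℂ) * φ x) :
    IsSpectralMeasure A (multiplicationPVM W hm) where
  mem_domain_iff f := by
    obtain ⟨φ, rfl⟩ := W.surjective f
    have hmeas : AEStronglyMeasurable (fun x => (m x : ℂ) * φ x) μ :=
      (Complex.measurable_ofReal.comp hm).aestronglyMeasurable.mul (Lp.aestronglyMeasurable φ)
    have hdens : AEMeasurable (fun x => ENNReal.ofReal (‖φ x‖ ^ 2)) μ :=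
      (integrable_norm_sq_Lp_two φ).aestronglyMeasurable.aemeasurable.ennreal_ofReal
    have h1 : W φ ∈ A.domain ↔ MemLp (fun x => (m x : ℂ) * φ x) 2 μ := by
      rw [LinearPMap.mem_domain_iff]
      constructor
      · rintro ⟨y, hy⟩
        obtain ⟨ψ, rfl⟩ := W.surjective y
        exact (memLp_congr_ae ((hA φ ψ).1 hy)).1 (Lp.memLp ψ)
      · intro h
        exact ⟨W (h.toLp _), (hA _ _).2 h.coeFn_toLp⟩
    rw [h1, memLp_two_iff_integrable_sq_norm hmeas, scalarMeasure_multiplicationPVM,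
      lintegral_map (by fun_prop) hm, lintegral_withDensity_eq_lintegral_mul₀ hdens (by fun_prop)]
    have h2 : ∀ x, ((fun x => ENNReal.ofReal (‖φ x‖ ^ 2)) * fun x => ENNReal.ofReal (m x ^ 2)) x =
        ENNReal.ofReal (‖(m x : ℂ) * φ x‖ ^ 2) := by
      intro x
      rw [Pi.mul_apply, ← ENNReal.ofReal_mul (by positivity), norm_mul, mul_pow, Complex.norm_real,
        Real.norm_eq_abs, sq_abs, mul_comm]
    simp only [h2]
    rw [← hasFiniteIntegral_iff_ofReal (Eventually.of_forall fun x => by positivity)]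
    exact ⟨fun h => h.2, fun h => ⟨hmeas.norm.pow 2, h⟩⟩
  inner_apply f := by
    obtain ⟨f, hf⟩ := f
    obtain ⟨φ, rfl⟩ := W.surjective f
    obtain ⟨ψ, hψ⟩ := W.surjective (A ⟨W φ, hf⟩)
    have hae := (hA φ ψ).1 (by rw [hψ]; exact A.mem_graph ⟨W φ, hf⟩)
    rw [← hψ]
    change inner ℂ (W φ) (W ψ) = _
    rw [W.inner_map_map, L2.inner_def, scalarMeasure_multiplicationPVM,
      integral_map hm.aemeasurable (by fun_prop),
      integral_withDensity_eq_integral_toReal_smul₀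
        (integrable_norm_sq_Lp_two φ).aestronglyMeasurable.aemeasurable.ennreal_ofReal
        (Eventually.of_forall fun x => ENNReal.ofReal_lt_top), ← integral_complex_ofReal]
    refine integral_congr_ae ?_
    filter_upwards [hae] with x hx
    rw [hx, ENNReal.toReal_ofReal (by positivity), RCLike.inner_apply, smul_eq_mul]
    push_cast
    rw [← Complex.mul_conj']
    ring

end Multiplication

/-! ### The `L²` Fourier transform and Fourier integrals -/

section FourierIntegral

open scoped FourierTransform RealInnerProductSpace ContDiff
open scoped Real

/-- The inverse Fourier integral `t ↦ ∫ φ(ξ) exp(2πiξt) dξ`. -/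
noncomputable def expInt (φ : ℝ → ℂ) (t : ℝ) : ℂ :=
  ∫ ξ, φ ξ * Complex.exp ((2 * π * ξ * t : ℝ) * Complex.I)

theorem expInt_eq_fourierInv (φ : ℝ → ℂ) : expInt φ = 𝓕⁻ φ := by
  ext t
  rw [Real.fourierInv_eq', expInt]
  refine integral_congr_ae (Eventually.of_forall fun ξ => ?_)
  simp only [smul_eq_mul]
  rw [mul_comm]
  congr 3
  push_cast
  simp only [RCLike.inner_apply, conj_trivial, Complex.ofReal_mul]
  ring

theorem expInt_eq_fourier (φ : ℝ → ℂ) (t : ℝ) : expInt φ t = 𝓕 φ (-t) := by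
  rw [expInt_eq_fourierInv, Real.fourierInv_eq_fourier_neg]

theorem integral_fourier_mul_flip {f g : ℝ → ℂ} (hf : Integrable f) (hg : Integrable g) :
    ∫ t, 𝓕 f t * g t = ∫ t, f t * 𝓕 g t := by
  have := VectorFourier.integral_fourierIntegral_smul_eq_flip (μ := volume) (ν := volume)
    (L := innerₗ ℝ) Real.continuous_fourierChar continuous_inner hf hg
  rw [flip_innerₗ] at this
  exact this

/-- Both sides have the same pairing with every test function: the `L²` transform by compatibility
with tempered distributions, the integral by Fubini. -/
theorem coeFn_fourier_Lp_two (φ : L2R) (hφ : Integrable φ) : (𝓕 φ : L2R) =ᵐ[volume] 𝓕 (φ : ℝ → ℂ) := by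
  refine ae_eq_of_integral_contDiff_smul_eq ((Lp.memLp _).locallyIntegrable (by norm_num))
    (Continuous.locallyIntegrable ?_) ?_
  · exact VectorFourier.fourierIntegral_continuous Real.continuous_fourierChar
      (by exact continuous_inner) hφ
  · intro g g_smooth g_cpt
    have hg₁ : HasCompactSupport (Complex.ofRealCLM ∘ g) := g_cpt.comp_left rfl
    have hg₂ : ContDiff ℝ ∞ (Complex.ofRealCLM ∘ g) := by fun_prop
    set G := hg₁.toSchwartzMap hg₂ with hG
    have h1 := congrArg (fun T => T G) (Lp.fourier_toTemperedDistribution_eq φ)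
    simp only [TemperedDistribution.fourier_apply, Lp.toTemperedDistribution_apply] at h1
    have h2 := integral_fourier_mul_flip hφ G.integrable
    calc ∫ x, g x • (𝓕 φ : L2R) x = ∫ x, G x • (𝓕 φ : L2R) x := by simp [hG]
      _ = ∫ x, (𝓕 G) x • φ x := h1.symm
      _ = ∫ x, φ x * 𝓕 (G : ℝ → ℂ) x := by
          refine integral_congr_ae (Eventually.of_forall fun x => ?_)
          simp only [smul_eq_mul, SchwartzMap.fourier_coe]
          ring
      _ = ∫ x, 𝓕 (φ : ℝ → ℂ) x * G x := h2.symm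
      _ = ∫ x, g x • 𝓕 (φ : ℝ → ℂ) x := by simp [hG, mul_comm]

theorem coeFn_fourierInv_Lp_two (φ : L2R) (hφ : Integrable φ) :
    (𝓕⁻ φ : L2R) =ᵐ[volume] expInt φ := by
  refine ae_eq_of_integral_contDiff_smul_eq ((Lp.memLp _).locallyIntegrable (by norm_num))
    (Continuous.locallyIntegrable ?_) ?_
  · have h : Continuous (𝓕 (φ : ℝ → ℂ)) :=
      VectorFourier.fourierIntegral_continuous Real.continuous_fourierChar
        (by exact continuous_inner) hφ
    have : expInt φ = fun t => 𝓕 (φ : ℝ → ℂ) (-t) := funext fun t => expInt_eq_fourier _ _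
    rw [this]
    exact h.comp continuous_neg
  · intro g g_smooth g_cpt
    have hg₁ : HasCompactSupport (Complex.ofRealCLM ∘ g) := g_cpt.comp_left rfl
    have hg₂ : ContDiff ℝ ∞ (Complex.ofRealCLM ∘ g) := by fun_prop
    set G := hg₁.toSchwartzMap hg₂ with hG
    have h1 := congrArg (fun T => T G) (Lp.fourierInv_toTemperedDistribution_eq φ)
    simp only [TemperedDistribution.fourierInv_apply, Lp.toTemperedDistribution_apply] at h1
    have h2 := integral_fourier_mul_flip hφ (G.integrable (μ := volume)).comp_neg
    calc ∫ x, g x • (𝓕⁻ φ : L2R) x = ∫ x, G x • (𝓕⁻ φ : L2R) x := by simp [hG]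
      _ = ∫ x, (𝓕⁻ G) x • φ x := h1.symm
      _ = ∫ x, φ x * 𝓕 (fun y => G (-y)) x := by
          refine integral_congr_ae (Eventually.of_forall fun x => ?_)
          simp only [smul_eq_mul, SchwartzMap.fourierInv_coe, Real.fourierInv_eq_fourier_comp_neg]
          ring
      _ = ∫ x, 𝓕 (φ : ℝ → ℂ) x * G (-x) := h2.symm
      _ = ∫ x, 𝓕 (φ : ℝ → ℂ) (-x) * G x := by
          rw [← integral_neg_eq_self]; simp
      _ = ∫ x, g x • expInt φ x := by simp [hG, mul_comm, expInt_eq_fourier]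

/-! ### Primitives of locally integrable functions. -/

/-- `u` is a primitive of the locally integrable function `g`. -/
structure IsPrimitive (u g : ℝ → ℂ) : Prop where
  locallyIntegrable : LocallyIntegrable g
  sub_eq : ∀ x y, u y - u x = ∫ t in x..y, g t

theorem LocallyIntegrable.intervalIntegrable' {g : ℝ → ℂ} (hg : LocallyIntegrable g) (a b : ℝ) :
    IntervalIntegrable g volume a b :=
  (hg.integrableOn_isCompact isCompact_uIcc).intervalIntegrable

theorem IsPrimitive.ae_hasDerivAt {u g : ℝ → ℂ} (h : IsPrimitive u g) :
    ∀ᵐ x, HasDerivAt u (g x) x := by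
  filter_upwards [LocallyIntegrable.ae_hasDerivAt_integral h.locallyIntegrable] with x hx
  have : u = fun y => (∫ t in (0:ℝ)..y, g t) + u 0 := by
    ext y; rw [← h.sub_eq]; ring
  rw [this]
  exact (hx 0).add_const _

/-- Increments of `u` are dominated by those of the indefinite integral of `‖g‖`, which is
absolutely continuous. -/
theorem IsPrimitive.locallyAC {u g : ℝ → ℂ} (h : IsPrimitive u g) : LocallyAC u := by
  intro a b
  have hi := (LocallyIntegrable.intervalIntegrable' h.locallyIntegrable a b).norm
  have hac := hi.absolutelyContinuousOnInterval_intervalIntegral (c := a) left_mem_uIcc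
  rw [absolutelyContinuousOnInterval_iff] at hac ⊢
  intro ε hε
  obtain ⟨δ, hδ, H⟩ := hac ε hε
  refine ⟨δ, hδ, fun E hE hlt => (Finset.sum_le_sum fun i hi => ?_).trans_lt (H E hE hlt)⟩
  have hn := fun a b => (LocallyIntegrable.intervalIntegrable' h.locallyIntegrable a b).norm
  rw [dist_comm, dist_eq_norm, h.sub_eq, dist_comm, Real.dist_eq,
    intervalIntegral.integral_interval_sub_left (hn _ _) (hn _ _)]
  exact intervalIntegral.norm_integral_le_abs_integral_norm

theorem IsPrimitive.add {u g u' g' : ℝ → ℂ} (h : IsPrimitive u g) (h' : IsPrimitive u' g') :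
    IsPrimitive (fun x => u x + u' x) (fun x => g x + g' x) where
  locallyIntegrable := h.locallyIntegrable.add h'.locallyIntegrable
  sub_eq x y := by
    rw [intervalIntegral.integral_add (LocallyIntegrable.intervalIntegrable' h.locallyIntegrable _ _)
      (LocallyIntegrable.intervalIntegrable' h'.locallyIntegrable _ _), ← h.sub_eq, ← h'.sub_eq]
    ring

theorem IsPrimitive.const_mul {u g : ℝ → ℂ} (h : IsPrimitive u g) (c : ℂ) :
    IsPrimitive (fun x => c * u x) (fun x => c * g x) where
  locallyIntegrable := h.locallyIntegrable.smul c
  sub_eq x y := by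
    rw [intervalIntegral.integral_const_mul, ← h.sub_eq]
    ring

theorem IsPrimitive.comp_mul {u g : ℝ → ℂ} (h : IsPrimitive u g) {k : ℝ} (hk : k ≠ 0) :
    IsPrimitive (fun x => u (k * x)) (fun x => k * g (k * x)) where
  locallyIntegrable := by
    have h1 : LocallyIntegrable (fun x => g (k * x)) := by
      rw [locallyIntegrable_iff]
      intro K hK
      obtain ⟨R, hR⟩ := hK.isBounded.subset_closedBall 0
      rw [Real.closedBall_eq_Icc] at hR
      have hi := (LocallyIntegrable.intervalIntegrable' h.locallyIntegrable (k * (0 - R))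
        (k * (0 + R))).comp_mul_left (c := k)
      rw [mul_div_cancel_left₀ _ hk, mul_div_cancel_left₀ _ hk] at hi
      -- The radius is not known to be nonnegative; if `R < 0` the compact set is empty.
      rcases le_total (0 - R) (0 + R) with hle | hle
      · exact ((intervalIntegrable_iff_integrableOn_Icc_of_le hle).1 hi).mono_set hR
      · rcases hle.eq_or_lt with he | hlt
        · exact ((intervalIntegrable_iff_integrableOn_Icc_of_le he.ge).1 hi).mono_set hR
        · rw [Icc_eq_empty (by linarith)] at hR
          rw [subset_empty_iff.1 hR]
          exact integrableOn_empty
    exact h1.smul (k : ℂ)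
  sub_eq x y := by
    rw [intervalIntegral.integral_const_mul, intervalIntegral.integral_comp_mul_left g hk,
      ← h.sub_eq, Complex.real_smul]
    push_cast
    rw [mul_inv_cancel_left₀ (by exact_mod_cast hk)]

/-- Matching values at `0` suffice, with no condition on `g` and `g'`. It is applied to `u` and to
the flux `p u'`, where the two value conditions are the interface conditions of the operator. -/
theorem IsPrimitive.glue {u g u' g' : ℝ → ℂ} (h : IsPrimitive u g) (h' : IsPrimitive u' g')
    (h0 : u 0 = u' 0) :
    IsPrimitive (fun x => if x ≤ 0 then u x else u' x) (fun x => if x ≤ 0 then g x else g' x) := by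
  set v := fun x : ℝ => if x ≤ 0 then u x else u' x with hv
  set k := fun x : ℝ => if x ≤ 0 then g x else g' x with hk
  have hind : k = (Iic 0).indicator g + (Ioi 0).indicator g' := by
    ext x
    by_cases hx : x ≤ 0
    · simp [hk, hx]
    · simp [hk, hx, not_le.1 hx]
  have hloc : LocallyIntegrable k := by
    rw [hind]
    exact (h.locallyIntegrable.indicator measurableSet_Iic).add
      (h'.locallyIntegrable.indicator measurableSet_Ioi)
  have key : ∀ y, v y - v 0 = ∫ t in (0:ℝ)..y, k t := by
    intro y
    rcases le_or_gt y 0 with hy | hy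
    · simp only [hv, hy, if_true, le_refl]
      rw [h.sub_eq]
      refine intervalIntegral.integral_congr fun t ht => ?_
      rw [uIcc_of_ge hy] at ht
      simp [hk, ht.2]
    · simp only [hv, not_le.2 hy, if_false, le_refl, if_true]
      rw [h0, h'.sub_eq]
      refine intervalIntegral.integral_congr_ae (Eventually.of_forall fun t ht => ?_)
      rw [uIoc_of_le hy.le] at ht
      simp [hk, ht.1]
  refine ⟨hloc, fun x y => ?_⟩
  rw [← intervalIntegral.integral_interval_sub_left
    (LocallyIntegrable.intervalIntegrable' hloc 0 y) (LocallyIntegrable.intervalIntegrable' hloc 0 x),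
    ← key, ← key]
  ring

/-! ### Differentiation of inverse Fourier integrals. -/

theorem norm_exp_real_mul_I (s : ℝ) : ‖Complex.exp ((s : ℝ) * Complex.I)‖ = 1 :=
  Complex.norm_exp_ofReal_mul_I s

theorem integrable_mul_exp {φ : ℝ → ℂ} (hφ : Integrable φ) (t : ℝ) :
    Integrable fun ξ => φ ξ * Complex.exp ((2 * π * ξ * t : ℝ) * Complex.I) :=
  hφ.mul_bdd (c := 1) (by fun_prop : Continuous fun ξ : ℝ =>
    Complex.exp ((2 * π * ξ * t : ℝ) * Complex.I)).aestronglyMeasurable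
    (Eventually.of_forall fun ξ => (norm_exp_real_mul_I _).le)

theorem continuous_expInt {φ : ℝ → ℂ} (hφ : Integrable φ) : Continuous (expInt φ) := by
  refine continuous_of_dominated (bound := fun ξ => ‖φ ξ‖) (fun t =>
    (integrable_mul_exp hφ t).aestronglyMeasurable) (fun t => Eventually.of_forall fun ξ => ?_)
    hφ.norm (Eventually.of_forall fun ξ => by fun_prop)
  rw [norm_mul, norm_exp_real_mul_I, mul_one]

theorem integral_exp_interval (ξ a b : ℝ) :
    (2 * π * ξ * Complex.I) * ∫ t in a..b, Complex.exp ((2 * π * ξ * t : ℝ) * Complex.I) =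
      Complex.exp ((2 * π * ξ * b : ℝ) * Complex.I) -
        Complex.exp ((2 * π * ξ * a : ℝ) * Complex.I) := by
  by_cases hξ : ξ = 0
  · simp [hξ]
  have hc : (2 * π * ξ * Complex.I : ℂ) ≠ 0 := by
    simp [hξ, Real.pi_ne_zero]
  have h := integral_exp_mul_complex (a := a) (b := b) hc
  have e : ∀ t : ℝ, ((2 * π * ξ * t : ℝ) : ℂ) * Complex.I = 2 * π * ξ * Complex.I * t := by
    intro t; push_cast; ring
  simp only [e]
  rw [h, mul_div_cancel₀ _ hc]

theorem expInt_isPrimitive {φ : ℝ → ℂ} (hφ : Integrable φ)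
    (hφ' : Integrable fun ξ : ℝ => (2 * π * ξ * Complex.I) * φ ξ) :
    IsPrimitive (expInt φ) (expInt fun ξ : ℝ => (2 * π * ξ * Complex.I) * φ ξ) where
  locallyIntegrable := (continuous_expInt hφ').locallyIntegrable
  sub_eq a b := by
    have hfub : ∫ t in a..b, expInt (fun ξ : ℝ => (2 * π * ξ * Complex.I) * φ ξ) t =
        ∫ ξ : ℝ, ∫ t in a..b, (2 * π * ξ * Complex.I) * φ ξ *
          Complex.exp ((2 * π * ξ * t : ℝ) * Complex.I) := by
      refine intervalIntegral_integral_swap ?_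
      rw [uIoc]
      have : Integrable (fun z : ℝ × ℝ => (1 : ℂ) * ((2 * π * z.2 * Complex.I) * φ z.2))
          ((volume.restrict (Ioc (min a b) (max a b))).prod volume) :=
        (integrable_const (1 : ℂ)).mul_prod hφ'
      simp only [one_mul] at this
      exact this.mul_bdd (c := 1) (by fun_prop : Continuous fun z : ℝ × ℝ =>
        Complex.exp ((2 * π * z.2 * z.1 : ℝ) * Complex.I)).aestronglyMeasurable
        (Eventually.of_forall fun ξ => (norm_exp_real_mul_I _).le)
    rw [hfub, expInt, expInt, ← integral_sub (integrable_mul_exp hφ b) (integrable_mul_exp hφ a)]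
    refine integral_congr_ae (Eventually.of_forall fun ξ => ?_)
    simp only
    rw [intervalIntegral.integral_const_mul, mul_right_comm (2 * (π : ℂ) * ξ * Complex.I),
      integral_exp_interval]
    ring

/-- For the second derivative the symbol times `φ` is only in `L²`, so Fubini does not apply.
Instead the `L²` inverse transform of `ψ` is paired with the indicator of `(a, b]`, and Plancherel
moves the pairing to the frequency side, where the transform of the indicator is explicit. -/
theorem expInt_isPrimitive_Lp {φ ψ : L2R}
    (hφ' : Integrable fun ξ : ℝ => (2 * π * ξ * Complex.I) * φ ξ)
    (hψ : ψ =ᵐ[volume] fun ξ : ℝ => (((2 * π * ξ) ^ 2 : ℝ) : ℂ) * φ ξ) :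
    IsPrimitive (expInt fun ξ : ℝ => (2 * π * ξ * Complex.I) * φ ξ)
      (fun t => -(𝓕⁻ ψ : L2R) t) := by
  have hloc : LocallyIntegrable (fun t => -(𝓕⁻ ψ : L2R) t) :=
    ((Lp.memLp (𝓕⁻ ψ : L2R)).locallyIntegrable (by norm_num)).neg
  have key : ∀ a b : ℝ, a ≤ b → expInt (fun ξ : ℝ => (2 * π * ξ * Complex.I) * φ ξ) b -
      expInt (fun ξ : ℝ => (2 * π * ξ * Complex.I) * φ ξ) a = ∫ t in a..b, -(𝓕⁻ ψ : L2R) t := by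
    intro a b hab
    have hfin : volume (Ioc a b) ≠ ⊤ := by simp
    set χ : L2R := indicatorConstLp 2 measurableSet_Ioc hfin (1 : ℂ) with hχ
    have hχc : χ =ᵐ[volume] (Ioc a b).indicator fun _ => (1 : ℂ) := indicatorConstLp_coeFn
    have hχi : Integrable χ :=
      ((integrable_indicator_iff measurableSet_Ioc).2 (integrableOn_const hfin)).congr hχc.symm
    have h1 : inner ℂ χ (𝓕⁻ ψ : L2R) = ∫ t in a..b, (𝓕⁻ ψ : L2R) t := by
      rw [hχ, L2.inner_indicatorConstLp_one, intervalIntegral.integral_of_le hab]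
    have h2 : inner ℂ χ (𝓕⁻ ψ : L2R) = inner ℂ (𝓕 χ : L2R) ψ := by
      rw [← Lp.inner_fourier_eq, FourierTransform.fourier_fourierInv_eq]
    have h3 : ∀ ξ, 𝓕 (χ : ℝ → ℂ) ξ =
        (starRingEnd ℂ) (∫ t in a..b, Complex.exp ((2 * π * ξ * t : ℝ) * Complex.I)) := by
      intro ξ
      rw [Real.fourier_congr_ae hχc, Real.fourier_eq', intervalIntegral.integral_of_le hab,
        ← integral_conj, ← integral_indicator measurableSet_Ioc]
      refine integral_congr_ae (Eventually.of_forall fun t => ?_)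
      by_cases ht : t ∈ Ioc a b
      · simp only [indicator_of_mem ht, ← Complex.exp_conj]
        rw [smul_eq_mul, mul_one]
        congr 1
        simp only [map_mul, Complex.conj_ofReal, Complex.conj_I, RCLike.inner_apply, conj_trivial]
        push_cast
        ring
      · simp [indicator_of_notMem ht]
    rw [intervalIntegral.integral_neg, ← h1, h2, L2.inner_def, expInt, expInt,
      ← integral_sub (integrable_mul_exp hφ' b) (integrable_mul_exp hφ' a), ← integral_neg]
    refine integral_congr_ae ?_
    filter_upwards [coeFn_fourier_Lp_two χ hχi, hψ] with ξ e1 e2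
    rw [e1, e2, h3, RCLike.inner_apply, Complex.conj_conj, ← mul_sub, ← integral_exp_interval]
    generalize ∫ t in a..b, Complex.exp ((2 * π * ξ * t : ℝ) * Complex.I) = J
    push_cast
    linear_combination (4 * π ^ 2 * ξ ^ 2 * φ ξ * J) * Complex.I_sq
  refine ⟨hloc, fun a b => ?_⟩
  rcases le_total a b with hab | hab
  · exact key a b hab
  · rw [intervalIntegral.integral_symm, ← key b a hab]; ring

end FourierIntegral

/-! ### Weighted composition isometries of `L²(ℝ)` -/

section WeightedComp

/-- The identity `h` says that `θ` pushes `w² dx` forward to `dx`. As `w` never vanishes, preimages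
of null sets are null, so composition with `θ` is well defined on almost-everywhere classes. -/
theorem quasiMeasurePreserving_of_lintegral {θ w : ℝ → ℝ} (hθ : Measurable θ)
    (hw : ∀ x, w x ≠ 0) (hwm : Measurable w)
    (h : ∀ g : ℝ → ℝ≥0∞, Measurable g → ∫⁻ x, ENNReal.ofReal (w x ^ 2) * g (θ x) = ∫⁻ x, g x) :
    Measure.QuasiMeasurePreserving θ volume volume := by
  refine ⟨hθ, Measure.AbsolutelyContinuous.mk fun s hs h0 => ?_⟩
  rw [Measure.map_apply hθ hs]
  have h1 := h (s.indicator 1) (measurable_one.indicator hs)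
  have hi : Measurable fun x => s.indicator (1 : ℝ → ℝ≥0∞) (θ x) :=
    (measurable_one.indicator hs).comp hθ
  rw [lintegral_indicator_one hs, h0, lintegral_eq_zero_iff (f := fun x => ENNReal.ofReal (w x ^ 2) * s.indicator 1 (θ x))
    (Measurable.mul (f := fun x => ENNReal.ofReal (w x ^ 2)) (by fun_prop) hi)] at h1
  rw [measure_eq_zero_iff_ae_notMem]
  filter_upwards [h1] with x hx hmem
  have hmem' : θ x ∈ s := hmem
  simp [hmem'] at hx
  exact hw x hx

theorem eLpNorm_weightedComp {θ w : ℝ → ℝ}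
    (h : ∀ g : ℝ → ℝ≥0∞, Measurable g → ∫⁻ x, ENNReal.ofReal (w x ^ 2) * g (θ x) = ∫⁻ x, g x)
    (F : L2R) : eLpNorm (fun x => (w x : ℂ) * F (θ x)) 2 volume = eLpNorm F 2 volume := by
  rw [eLpNorm_eq_lintegral_rpow_enorm_toReal two_ne_zero ENNReal.ofNat_ne_top,
    eLpNorm_eq_lintegral_rpow_enorm_toReal two_ne_zero ENNReal.ofNat_ne_top,
    ← h (fun x => ‖F x‖ₑ ^ (2 : ℝ≥0∞).toReal)
      ((Lp.stronglyMeasurable F).measurable.enorm.pow_const _)]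
  congr 2
  ext x
  rw [enorm_mul, ENNReal.mul_rpow_of_nonneg _ _ (by norm_num)]
  congr 1
  simp only [ENNReal.toReal_ofNat, ENNReal.rpow_ofNat]
  rw [← ofReal_norm, ← ENNReal.ofReal_pow (norm_nonneg _), Complex.norm_real,
    Real.norm_eq_abs, sq_abs]

theorem memLp_weightedComp {θ w : ℝ → ℝ} (hq : Measure.QuasiMeasurePreserving θ volume volume)
    (hwm : Measurable w)
    (h : ∀ g : ℝ → ℝ≥0∞, Measurable g → ∫⁻ x, ENNReal.ofReal (w x ^ 2) * g (θ x) = ∫⁻ x, g x)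
    (F : L2R) : MemLp (fun x => (w x : ℂ) * F (θ x)) 2 volume :=
  ⟨(by fun_prop : Measurable fun x => (w x : ℂ)).aestronglyMeasurable.mul
      ((Lp.aestronglyMeasurable F).comp_quasiMeasurePreserving hq),
    by rw [eLpNorm_weightedComp h]; exact Lp.eLpNorm_lt_top F⟩

/-- The isometry `F ↦ w · (F ∘ θ)` of `L²(ℝ)`. -/
noncomputable def weightedComp (θ w : ℝ → ℝ) (hq : Measure.QuasiMeasurePreserving θ volume volume)
    (hwm : Measurable w)
    (h : ∀ g : ℝ → ℝ≥0∞, Measurable g → ∫⁻ x, ENNReal.ofReal (w x ^ 2) * g (θ x) = ∫⁻ x, g x) :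
    L2R →ₗᵢ[ℂ] L2R where
  toFun := fun F => (memLp_weightedComp hq hwm h F).toLp _
  map_add' := fun F G => by
    refine Lp.ext ?_
    filter_upwards [(memLp_weightedComp hq hwm h (F + G)).coeFn_toLp, (memLp_weightedComp hq hwm h F).coeFn_toLp, (memLp_weightedComp hq hwm h G).coeFn_toLp,
      Lp.coeFn_add ((memLp_weightedComp hq hwm h F).toLp _) ((memLp_weightedComp hq hwm h G).toLp _), hq.ae (Lp.coeFn_add F G)]
      with x h1 h2 h3 h4 h5
    rw [h1, h4, Pi.add_apply, h2, h3, h5, Pi.add_apply, mul_add]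
  map_smul' := fun c F => by
    refine Lp.ext ?_
    filter_upwards [(memLp_weightedComp hq hwm h (c • F)).coeFn_toLp, (memLp_weightedComp hq hwm h F).coeFn_toLp,
      Lp.coeFn_smul c ((memLp_weightedComp hq hwm h F).toLp _), hq.ae (Lp.coeFn_smul c F)] with x h1 h2 h4 h5
    rw [h1, RingHom.id_apply, h4, Pi.smul_apply, h2, h5, Pi.smul_apply, smul_eq_mul, smul_eq_mul]
    ring
  norm_map' := fun F => by
    simp only [LinearMap.coe_mk, AddHom.coe_mk]
    rw [Lp.norm_toLp, eLpNorm_weightedComp h]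
    rfl

theorem coeFn_weightedComp {θ w : ℝ → ℝ} (hq : Measure.QuasiMeasurePreserving θ volume volume)
    (hwm : Measurable w)
    (h : ∀ g : ℝ → ℝ≥0∞, Measurable g → ∫⁻ x, ENNReal.ofReal (w x ^ 2) * g (θ x) = ∫⁻ x, g x)
    (F : L2R) : weightedComp θ w hq hwm h F =ᵐ[volume] fun x => (w x : ℂ) * F (θ x) :=
  (memLp_weightedComp hq hwm h F).coeFn_toLp

/-- The rotation `x • F + y • J F` generated by an isometry `J` with `J² = -1`. -/
noncomputable def skewRotation {H : Type*} [NormedAddCommGroup H] [InnerProductSpace ℂ H]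
    (J : H →ₗᵢ[ℂ] H) (hJ : ∀ F, J (J F) = -F) (x y : ℝ) (hxy : x ^ 2 + y ^ 2 = 1) : H ≃ₗᵢ[ℂ] H :=
  have hc : (x : ℂ) ^ 2 + (y : ℂ) ^ 2 = 1 := by exact_mod_cast hxy
  { toFun := fun F => (x : ℂ) • F + (y : ℂ) • J F
    invFun := fun F => (x : ℂ) • F - (y : ℂ) • J F
    map_add' := fun F G => by
      simp only [map_add, smul_add]
      abel
    map_smul' := fun c F => by
      simp only [map_smul, RingHom.id_apply, smul_add, smul_comm c]
    left_inv := fun F => by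
      simp only [map_add, map_smul, hJ, smul_add, smul_neg, smul_smul]
      rw [mul_comm (y : ℂ) x, ← sq, ← sq]
      calc _ = ((x : ℂ) ^ 2 + (y : ℂ) ^ 2) • F := by module
        _ = F := by rw [hc, one_smul]
    right_inv := fun F => by
      simp only [map_sub, map_smul, hJ, smul_sub, smul_neg, smul_smul]
      rw [mul_comm (y : ℂ) x, ← sq, ← sq]
      calc _ = ((x : ℂ) ^ 2 + (y : ℂ) ^ 2) • F := by module
        _ = F := by rw [hc, one_smul]
    norm_map' := fun F => by
      -- An isometry with `J² = -1` is skew, so `⟨F, J F⟩` is purely imaginary and the cross term in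
      -- the norm disappears.
      have h1 : inner ℂ F (J F) = -inner ℂ (J F) F := by
        rw [← J.inner_map_map, hJ, inner_neg_right]
      have h2 : RCLike.re (inner ℂ F (J F)) = 0 := by
        have h3 := congrArg RCLike.re h1
        rw [map_neg, ← inner_conj_symm (J F) F, RCLike.conj_re] at h3
        linarith
      have h4 : ‖(x : ℂ) • F + (y : ℂ) • J F‖ ^ 2 = ‖F‖ ^ 2 := by
        rw [norm_add_sq (𝕜 := ℂ), inner_smul_left, inner_smul_right, norm_smul, norm_smul,
          J.norm_map, Complex.norm_real, Complex.norm_real, mul_pow, mul_pow, Complex.conj_ofReal,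
          Real.norm_eq_abs, Real.norm_eq_abs, sq_abs, sq_abs, ← mul_assoc, ← Complex.ofReal_mul]
        rw [show RCLike.re (((x * y : ℝ) : ℂ) * inner ℂ F (J F)) =
          (x * y) * RCLike.re (inner ℂ F (J F)) from Complex.re_ofReal_mul _ _, h2]
        linear_combination ‖F‖ ^ 2 * hxy
      exact (sq_eq_sq₀ (norm_nonneg _) (norm_nonneg _)).1 h4 }

end WeightedComp

/-! ### The two-sided dilation and the odd reflection -/

section Toy

/-- The two-valued function equal to `r` on `x ≤ 0` and to `s` on `x > 0`. -/
noncomputable def twoSided (r s x : ℝ) : ℝ := if x ≤ 0 then r else s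

theorem measurable_twoSided (r s : ℝ) : Measurable (twoSided r s) :=
  Measurable.ite measurableSet_Iic measurable_const measurable_const

theorem twoSided_pos {r s : ℝ} (hr : 0 < r) (hs : 0 < s) (x : ℝ) : 0 < twoSided r s x := by
  unfold twoSided; split_ifs <;> assumption

theorem setLIntegral_comp_mul {k : ℝ} (hk : 0 < k) {s : Set ℝ} (hs : MeasurableSet s)
    (hsk : ∀ x, k * x ∈ s ↔ x ∈ s) {g : ℝ → ℝ≥0∞} (hg : Measurable g) :
    ∫⁻ x in s, ENNReal.ofReal k * g (k * x) = ∫⁻ x in s, g x := by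
  rw [← lintegral_indicator hs, ← lintegral_indicator hs]
  have h := Real.smul_map_volume_mul_left hk.ne'
  have hi : Measurable fun x => s.indicator g (k * x) :=
    (hg.indicator hs).comp (measurable_const_mul k)
  conv_rhs => rw [← h]
  rw [lintegral_smul_measure, lintegral_map (hg.indicator hs) (measurable_const_mul k),
    abs_of_pos hk, smul_eq_mul, ← lintegral_const_mul _ hi]
  congr 1
  ext x
  by_cases hx : x ∈ s
  · rw [indicator_of_mem hx, indicator_of_mem ((hsk x).2 hx)]
  · rw [indicator_of_notMem hx, indicator_of_notMem (mt (hsk x).1 hx), mul_zero]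

/-- Each half-line is invariant under positive dilation, and the squared weight is exactly the
Jacobian of the dilation there. -/
theorem lintegral_twoSided {r s : ℝ} (hr : 0 < r) (hs : 0 < s) (g : ℝ → ℝ≥0∞) (hg : Measurable g) :
    ∫⁻ x, ENNReal.ofReal (twoSided r s x ^ 2) * g (twoSided (r ^ 2) (s ^ 2) x * x) = ∫⁻ x, g x := by
  rw [← lintegral_add_compl _ (measurableSet_Iic (a := (0 : ℝ))),
    ← lintegral_add_compl g (measurableSet_Iic (a := (0 : ℝ)))]
  congr 1
  · rw [← setLIntegral_comp_mul (k := r ^ 2) (by positivity) measurableSet_Iic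
      (fun x => by simp only [mem_Iic, ← not_lt, mul_pos_iff_of_pos_left (pow_pos hr 2)]) hg]
    refine setLIntegral_congr_fun measurableSet_Iic fun x hx => ?_
    simp [twoSided, mem_Iic.1 hx]
  · rw [← setLIntegral_comp_mul (k := s ^ 2) (by positivity) measurableSet_Iic.compl
      (fun x => by simp [hs]) hg]
    refine setLIntegral_congr_fun measurableSet_Iic.compl fun x hx => ?_
    have : ¬ x ≤ 0 := hx
    simp [twoSided, this]

theorem measurable_twoSided_mul (r s : ℝ) : Measurable fun x => twoSided r s x * x :=
  (measurable_twoSided r s).mul measurable_id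

theorem quasiMeasurePreserving_twoSided {r s : ℝ} (hr : 0 < r) (hs : 0 < s) :
    Measure.QuasiMeasurePreserving (fun x => twoSided (r ^ 2) (s ^ 2) x * x) volume volume :=
  quasiMeasurePreserving_of_lintegral (measurable_twoSided_mul _ _)
    (fun x => (twoSided_pos hr hs x).ne') (measurable_twoSided r s) (lintegral_twoSided hr hs)

/-- The two-sided dilation as an isometry. -/
noncomputable def dilationIsometry {r s : ℝ} (hr : 0 < r) (hs : 0 < s) : L2R →ₗᵢ[ℂ] L2R :=
  weightedComp _ _ (quasiMeasurePreserving_twoSided hr hs) (measurable_twoSided r s)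
    (lintegral_twoSided hr hs)

theorem coeFn_dilationIsometry {r s : ℝ} (hr : 0 < r) (hs : 0 < s) (F : L2R) :
    dilationIsometry hr hs F =ᵐ[volume]
      fun x => (twoSided r s x : ℂ) * F (twoSided (r ^ 2) (s ^ 2) x * x) :=
  coeFn_weightedComp _ _ _ F

theorem dilationIsometry_inv {r s r' s' : ℝ} (hr : 0 < r) (hs : 0 < s) (hr' : 0 < r')
    (hs' : 0 < s') (h1 : r * r' = 1) (h2 : s * s' = 1) (F : L2R) :
    dilationIsometry hr hs (dilationIsometry hr' hs' F) = F := by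
  refine Lp.ext ?_
  filter_upwards [coeFn_dilationIsometry hr hs (dilationIsometry hr' hs' F),
    (quasiMeasurePreserving_twoSided hr hs).ae (coeFn_dilationIsometry hr' hs' F)] with x e1 e2
  rw [e1, e2]
  by_cases hx : x ≤ 0
  · have hx' : r ^ 2 * x ≤ 0 := mul_nonpos_of_nonneg_of_nonpos (by positivity) hx
    simp only [twoSided, hx, hx', if_true]
    rw [← mul_assoc, ← mul_assoc, ← Complex.ofReal_mul, h1, ← mul_pow, mul_comm r' r, h1]
    simp
  · have hx' : ¬ s ^ 2 * x ≤ 0 := by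
      rw [not_le] at hx ⊢
      positivity
    simp only [twoSided, hx, hx', if_false]
    rw [← mul_assoc, ← mul_assoc, ← Complex.ofReal_mul, h2, ← mul_pow, mul_comm s' s, h2]
    simp

/-- The two-sided dilation as a unitary operator. -/
noncomputable def dilation {r s : ℝ} (hr : 0 < r) (hs : 0 < s) : L2R ≃ₗᵢ[ℂ] L2R :=
  LinearIsometryEquiv.ofSurjective (dilationIsometry hr hs) fun F =>
    ⟨dilationIsometry (inv_pos.2 hr) (inv_pos.2 hs) F, dilationIsometry_inv _ _ _ _
      (mul_inv_cancel₀ hr.ne') (mul_inv_cancel₀ hs.ne') F⟩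

theorem coeFn_dilation {r s : ℝ} (hr : 0 < r) (hs : 0 < s) (F : L2R) :
    dilation hr hs F =ᵐ[volume]
      fun x => (twoSided r s x : ℂ) * F (twoSided (r ^ 2) (s ^ 2) x * x) :=
  coeFn_dilationIsometry hr hs F

theorem lintegral_oddReflection (g : ℝ → ℝ≥0∞) (_ : Measurable g) :
    ∫⁻ x, ENNReal.ofReal (twoSided (-1) 1 x ^ 2) * g (-x) = ∫⁻ x, g x := by
  rw [← lintegral_neg_eq_self]
  refine lintegral_congr fun x => ?_
  have : twoSided (-1) 1 (-x) ^ 2 = 1 := by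
    unfold twoSided; split_ifs <;> norm_num
  simp [this]

theorem quasiMeasurePreserving_neg_real :
    Measure.QuasiMeasurePreserving (fun x : ℝ => -x) volume volume :=
  (Measure.measurePreserving_neg (volume : Measure ℝ)).quasiMeasurePreserving

/-- The isometry `F(t) ↦ sgn(t) F(-t)`. -/
noncomputable def oddReflection : L2R →ₗᵢ[ℂ] L2R :=
  weightedComp (fun x => -x) (twoSided (-1) 1) quasiMeasurePreserving_neg_real
    (measurable_twoSided _ _) lintegral_oddReflection

theorem coeFn_oddReflection (F : L2R) :
    oddReflection F =ᵐ[volume] fun x => (twoSided (-1) 1 x : ℂ) * F (-x) :=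
  coeFn_weightedComp _ _ _ F

theorem oddReflection_oddReflection (F : L2R) : oddReflection (oddReflection F) = -F := by
  refine Lp.ext ?_
  -- At `0` the sign factor is `-1` both times, so the pointwise formula gives the wrong sign at
  -- this single point.
  have h0 : ∀ᵐ x : ℝ, x ≠ 0 := by simp [ae_iff]
  filter_upwards [coeFn_oddReflection (oddReflection F),
    quasiMeasurePreserving_neg_real.ae (coeFn_oddReflection F), Lp.coeFn_neg F, h0] with x e1 e2 e3 hx
  rw [e1, e2, e3, Pi.neg_apply, neg_neg]
  rcases lt_or_gt_of_ne hx with h | h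
  · simp [twoSided, h.le, not_le.2 h]
  · simp [twoSided, h.le, not_le.2 h]

/-! ### The unitary change of variables. -/

/-- `(α + β) / √(2 (α² + β²))`. -/
noncomputable def rotCos (α β : ℝ) : ℝ := (α + β) / √(2 * (α ^ 2 + β ^ 2))

/-- `(β - α) / √(2 (α² + β²))`. -/
noncomputable def rotSin (α β : ℝ) : ℝ := (β - α) / √(2 * (α ^ 2 + β ^ 2))

theorem rotCos_sq_add_rotSin_sq {α β : ℝ} (hα : 0 < α) (hβ : 0 < β) :
    rotCos α β ^ 2 + rotSin α β ^ 2 = 1 := by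
  rw [rotCos, rotSin, div_pow, div_pow, Real.sq_sqrt (by positivity)]
  field_simp
  ring

/-- The change of variables `F ↦ U F` with `u(x) = α⁻¹ (c F(x/α²) - s F(-x/α²))` for `x ≤ 0` and
`u(x) = β⁻¹ (c F(x/β²) + s F(-x/β²))` for `x > 0`. -/
noncomputable def toyMap (α β : ℝ) (F : ℝ → ℂ) (x : ℝ) : ℂ :=
  if x ≤ 0 then
    ((α⁻¹ * rotCos α β : ℝ) : ℂ) * F ((α⁻¹ ^ 2) * x) +
      ((-(α⁻¹ * rotSin α β) : ℝ) : ℂ) * F (-(α⁻¹ ^ 2) * x)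
  else
    ((β⁻¹ * rotCos α β : ℝ) : ℂ) * F ((β⁻¹ ^ 2) * x) +
      ((β⁻¹ * rotSin α β : ℝ) : ℂ) * F (-(β⁻¹ ^ 2) * x)

theorem toyMap_congr_ae {α β : ℝ} (hα : 0 < α) (hβ : 0 < β) {F G : ℝ → ℂ}
    (h : F =ᵐ[volume] G) : toyMap α β F =ᵐ[volume] toyMap α β G := by
  have hq := quasiMeasurePreserving_twoSided (inv_pos.2 hα) (inv_pos.2 hβ)
  filter_upwards [hq.ae h, (quasiMeasurePreserving_neg_real.comp hq).ae h] with x h1 h2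
  unfold toyMap
  by_cases hx : x ≤ 0
  · simp only [twoSided, hx, if_true, Function.comp_apply] at h1 h2 ⊢
    rw [neg_mul, h1, h2]
  · simp only [twoSided, hx, if_false, Function.comp_apply] at h1 h2 ⊢
    rw [neg_mul, h1, h2]

/-- The unitary operator on `L²(ℝ)` given by `toyMap`. -/
noncomputable def toyUnitary {α β : ℝ} (hα : 0 < α) (hβ : 0 < β) : L2R ≃ₗᵢ[ℂ] L2R :=
  (skewRotation oddReflection oddReflection_oddReflection (rotCos α β) (rotSin α β)
    (rotCos_sq_add_rotSin_sq hα hβ)).trans (dilation (inv_pos.2 hα) (inv_pos.2 hβ))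

theorem coeFn_toyUnitary {α β : ℝ} (hα : 0 < α) (hβ : 0 < β) (F : L2R) :
    toyUnitary hα hβ F =ᵐ[volume] toyMap α β F := by
  have hq := quasiMeasurePreserving_twoSided (inv_pos.2 hα) (inv_pos.2 hβ)
  have h1 := coeFn_dilation (inv_pos.2 hα) (inv_pos.2 hβ)
    (((rotCos α β : ℝ) : ℂ) • F + ((rotSin α β : ℝ) : ℂ) • oddReflection F)
  have h2 := Lp.coeFn_add (((rotCos α β : ℝ) : ℂ) • F) (((rotSin α β : ℝ) : ℂ) • oddReflection F)
  filter_upwards [h1, hq.ae h2, hq.ae (Lp.coeFn_smul ((rotCos α β : ℝ) : ℂ) F),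
    hq.ae (Lp.coeFn_smul ((rotSin α β : ℝ) : ℂ) (oddReflection F)),
    hq.ae (coeFn_oddReflection F)] with x h1 h2 h3 h4 h5
  refine h1.trans ?_
  rw [h2, Pi.add_apply, h3, h4, Pi.smul_apply, Pi.smul_apply, h5, smul_eq_mul, smul_eq_mul]
  unfold toyMap
  by_cases hx : x ≤ 0
  · have hx' : α⁻¹ ^ 2 * x ≤ 0 := mul_nonpos_of_nonneg_of_nonpos (by positivity) hx
    simp only [twoSided, hx, hx', if_true, neg_mul]
    push_cast
    ring
  · have hx' : ¬ β⁻¹ ^ 2 * x ≤ 0 := by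
      rw [not_le] at hx ⊢
      positivity
    simp only [twoSided, hx, hx', if_false, neg_mul]
    push_cast
    ring

end Toy

section SturmLiouville

open scoped FourierTransform Real

/-! ### Injectivity of `A_p + 1` -/

theorem le_of_ae_deriv_nonneg {f : ℝ → ℝ} {x y : ℝ} (hxy : x ≤ y)
    (hf : AbsolutelyContinuousOnInterval f x y) (h : ∀ᵐ t, t ∈ Icc x y → 0 ≤ deriv f t) :
    f x ≤ f y := by
  rw [← sub_nonneg, ← hf.integral_deriv_eq_sub]
  refine intervalIntegral.integral_nonneg_of_ae_restrict hxy ?_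
  rw [EventuallyLE, ae_restrict_iff' measurableSet_Icc]
  exact h

theorem not_integrable_of_le_on {f : ℝ → ℝ} {c : ℝ} (hc : 0 < c) {s : Set ℝ} (hs : volume s = ∞)
    (hsm : MeasurableSet s) (h : ∀ x ∈ s, c ≤ f x) : ¬ Integrable f := by
  intro hi
  have h1 : IntegrableOn (fun _ : ℝ => c) s := by
    refine Integrable.mono' hi.integrableOn aestronglyMeasurable_const ?_
    rw [ae_restrict_iff' hsm]
    refine Eventually.of_forall fun x hx => ?_
    rw [Real.norm_of_nonneg hc.le]
    exact h x hx
  rw [integrableOn_const_iff (by simp)] at h1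
  rcases h1 with h1 | h1
  · exact hc.ne' (enorm_eq_zero.1 h1)
  · exact h1.ne hs

/-- A real square integrable solution of `(p u')' = u`, `p > 0`, vanishes. -/
theorem eq_zero_of_sturmLiouville_eq_neg {p u v : ℝ → ℝ} (hp : ∀ x, 0 < p x)
    (hu : ∀ a b, AbsolutelyContinuousOnInterval u a b)
    (hv : ∀ a b, AbsolutelyContinuousOnInterval v a b)
    (hu' : ∀ᵐ x, HasDerivAt u (v x / p x) x) (hv' : ∀ᵐ x, HasDerivAt v (u x) x)
    (hi : Integrable fun x => u x ^ 2) : ∀ᵐ x, u x = 0 := by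
  have hN : ∀ᵐ x, HasDerivAt (u * v) (v x ^ 2 / p x + u x ^ 2) x := by
    filter_upwards [hu', hv'] with x h1 h2
    convert! h1.mul h2 using 1
    ring
  have hQ : ∀ᵐ x, HasDerivAt (u * u) (2 * (u x * v x) / p x) x := by
    filter_upwards [hu'] with x h1
    convert! h1.mul h1 using 1
    ring
  have hmono : Monotone (u * v) := fun x y hxy => by
    refine le_of_ae_deriv_nonneg hxy ((hu x y).mul (hv x y)) ?_
    filter_upwards [hN] with t ht _
    rw [ht.deriv]
    have := hp t
    positivity
  -- With `v = p u'`, the product `u v` is nondecreasing and `(u²)' = 2 u v / p`. If `u v` is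
  -- negative at `x`, then `u² ≥ u(x)²` on the half-line to the left of `x`; if positive, on the
  -- half-line to the right. Either contradicts integrability of `u²`.
  have hzero : ∀ x, u x * v x = 0 := by
    intro x
    by_contra hne
    have hux : 0 < u x * u x := by
      have : u x ≠ 0 := left_ne_zero_of_mul hne
      exact mul_self_pos.2 this
    rcases lt_or_gt_of_ne hne with hlt | hgt
    · refine not_integrable_of_le_on hux (s := Iic x) (by simp) measurableSet_Iic ?_ hi
      intro y hy
      have hac := ((hu y x).mul (hu y x)).neg
      have := le_of_ae_deriv_nonneg (mem_Iic.1 hy) hac (by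
        filter_upwards [hQ] with t ht htm
        rw [ht.neg.deriv]
        have h1 : u t * v t ≤ u x * v x := hmono htm.2
        have h2 := hp t
        rw [neg_nonneg]
        exact div_nonpos_of_nonpos_of_nonneg (by linarith) h2.le)
      simp only [Pi.neg_apply, Pi.mul_apply] at this
      nlinarith
    · refine not_integrable_of_le_on hux (s := Ici x) (by simp) measurableSet_Ici ?_ hi
      intro y hy
      have := le_of_ae_deriv_nonneg (mem_Ici.1 hy) ((hu x y).mul (hu x y)) (by
        filter_upwards [hQ] with t ht htm
        rw [ht.deriv]
        have h1 : u x * v x ≤ u t * v t := hmono htm.1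
        have h2 := hp t
        exact div_nonneg (by linarith) h2.le)
      simp only [Pi.mul_apply] at this
      nlinarith
  have hzero' : u * v = fun _ => 0 := funext hzero
  filter_upwards [hN] with x hx
  rw [hzero'] at hx
  have h1 := hx.unique (hasDerivAt_const x 0)
  have h2 : 0 ≤ v x ^ 2 / p x := div_nonneg (sq_nonneg _) (hp x).le
  have h3 : u x ^ 2 = 0 := by nlinarith [sq_nonneg (u x)]
  exact pow_eq_zero_iff two_ne_zero |>.1 h3

theorem LocallyAC.comp_clm {u : ℝ → ℂ} (hu : LocallyAC u) (L : ℂ →L[ℝ] ℝ) (hL : ∀ z, ‖L z‖ ≤ ‖z‖)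
    (a b : ℝ) : AbsolutelyContinuousOnInterval (fun x => L (u x)) a b := by
  have hac := hu a b
  rw [absolutelyContinuousOnInterval_iff] at hac ⊢
  intro ε hε
  obtain ⟨δ, hδ, H⟩ := hac ε hε
  refine ⟨δ, hδ, fun E hE hlt => (Finset.sum_le_sum fun i hi => ?_).trans_lt (H E hE hlt)⟩
  rw [dist_eq_norm, dist_eq_norm, ← map_sub]
  exact hL _

/-- This is the injectivity of `A_p + 1`. Since `p` is real, real and imaginary parts solve the
equation separately and the real case applies to each. -/
theorem sturmLiouvilleGraph_neg_eq_zero {p : ℝ → ℝ} (hp : ∀ x, 0 < p x) {f : L2R}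
    (hf : (f, -f) ∈ sturmLiouvilleGraph p) : f = 0 := by
  obtain ⟨u, v, hu, hv, h1, h2, h3⟩ := hf
  have hu2 : MemLp u 2 volume := (memLp_congr_ae h1).1 (Lp.memLp f)
  have key : ∀ L : ℂ →L[ℝ] ℝ, (∀ z, ‖L z‖ ≤ ‖z‖) → ∀ᵐ x, L (u x) = 0 := by
    intro L hL
    refine eq_zero_of_sturmLiouville_eq_neg (v := fun x => L (v x)) hp (hu.comp_clm L hL)
      (hv.comp_clm L hL) ?_ ?_ ?_
    · filter_upwards [h2, hu.ae_differentiableAt] with x e d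
      have : L (v x) / p x = L (deriv u x) := by
        rw [e, ← Complex.real_smul, map_smul, smul_eq_mul, mul_div_cancel_left₀ _ (hp x).ne']
      rw [this]
      exact L.hasFDerivAt.comp_hasDerivAt x d.hasDerivAt
    · filter_upwards [h1, h3, Lp.coeFn_neg f, hv.ae_differentiableAt] with x e1 e3 e4 d
      have : u x = deriv v x := by
        have e5 : (-f : L2R) x = - deriv v x := e3
        rw [e4, Pi.neg_apply, neg_inj] at e5
        rw [← e5]; exact e1.symm
      rw [this]
      exact L.hasFDerivAt.comp_hasDerivAt x d.hasDerivAt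
    · refine Integrable.mono' (hu2.integrable_norm_pow two_ne_zero)
        ((L.continuous.comp hu.continuous).pow 2).aestronglyMeasurable
        (Eventually.of_forall fun x => ?_)
      rw [norm_pow]
      exact pow_le_pow_left₀ (norm_nonneg _) (hL _) 2
  refine (Lp.eq_zero_iff_ae_eq_zero).mpr ?_
  filter_upwards [h1, key Complex.reCLM (fun z => Complex.abs_re_le_norm z),
    key Complex.imCLM (fun z => Complex.abs_im_le_norm z)] with x e1 e2 e3
  refine e1.trans (Complex.ext ?_ ?_)
  · exact e2
  · exact e3

/-! ### `A_p` as a multiplication operator -/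

/-- The symbol `(2πξ)²` of `-d²/dt²`. -/
noncomputable def freqSq (ξ : ℝ) : ℝ := (2 * π * ξ) ^ 2

theorem continuous_freqSq : Continuous freqSq := by unfold freqSq; fun_prop

theorem freqSq_nonneg (ξ : ℝ) : 0 ≤ freqSq ξ := sq_nonneg _

theorem integrable_inv_one_add_freqSq : Integrable fun ξ => (1 + freqSq ξ)⁻¹ :=
  integrable_inv_one_add_sq.comp_mul_left' (by positivity)

/-- Write `k φ` as the product of `k / (1 + freqSq)` and `φ + ψ`. The growth bound on `k` makes the
first factor square integrable, so the product is integrable by Cauchy–Schwarz. -/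
theorem integrable_mul_of_freqSq {φ ψ : L2R}
    (h : ψ =ᵐ[volume] fun ξ => (freqSq ξ : ℂ) * φ ξ) {k : ℝ → ℂ} (hk : Continuous k)
    (hk' : ∀ ξ, ‖k ξ‖ ^ 2 ≤ 1 + freqSq ξ) : Integrable fun ξ => k ξ * φ ξ := by
  have h1 : MemLp (fun ξ => k ξ * ((1 + freqSq ξ)⁻¹ : ℝ)) 2 volume := by
    have hc : Continuous fun ξ => k ξ * ((1 + freqSq ξ)⁻¹ : ℝ) := by
      refine hk.mul (Complex.continuous_ofReal.comp ?_)
      exact (continuous_const.add continuous_freqSq).inv₀ fun ξ =>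
        (by linarith [freqSq_nonneg ξ] : 0 < 1 + freqSq ξ).ne'
    rw [memLp_two_iff_integrable_sq_norm hc.aestronglyMeasurable]
    refine integrable_inv_one_add_freqSq.mono' (hc.norm.pow 2).aestronglyMeasurable (Eventually.of_forall fun ξ => ?_)
    have hpos : 0 < 1 + freqSq ξ := by have := freqSq_nonneg ξ; positivity
    rw [norm_pow, norm_norm, norm_mul, mul_pow, Complex.norm_real, Real.norm_of_nonneg (by positivity),
      inv_pow, ← div_eq_mul_inv, div_le_iff₀ (by positivity)]
    calc _ ≤ 1 + freqSq ξ := hk' ξ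
      _ = (1 + freqSq ξ)⁻¹ * (1 + freqSq ξ) ^ 2 := by field_simp
  have h2 := h1.integrable_mul (Lp.memLp (φ + ψ))
  refine h2.congr ?_
  filter_upwards [h, Lp.coeFn_add φ ψ] with ξ e1 e2
  have hpos : (1 + freqSq ξ : ℂ) ≠ 0 := by
    have := freqSq_nonneg ξ
    exact_mod_cast (by positivity : 1 + freqSq ξ ≠ 0)
  rw [Pi.mul_apply, e2, Pi.add_apply, e1]
  push_cast
  field_simp

theorem integrable_of_freqSq {φ ψ : L2R}
    (h : ψ =ᵐ[volume] fun ξ => (freqSq ξ : ℂ) * φ ξ) : Integrable φ := by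
  have := integrable_mul_of_freqSq h (k := fun _ => 1) continuous_const
    (fun ξ => by simpa using freqSq_nonneg ξ)
  simpa using this

theorem integrable_deriv_of_freqSq {φ ψ : L2R}
    (h : ψ =ᵐ[volume] fun ξ => (freqSq ξ : ℂ) * φ ξ) :
    Integrable fun ξ : ℝ => (2 * π * ξ * Complex.I) * φ ξ := by
  refine integrable_mul_of_freqSq h (k := fun ξ : ℝ => 2 * π * ξ * Complex.I) (by fun_prop)
    (fun ξ => ?_)
  have : ‖(2 * π * ξ * Complex.I : ℂ)‖ = |2 * π * ξ| := by
    rw [norm_mul, Complex.norm_I, mul_one]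
    rw [← Real.norm_eq_abs, ← Complex.norm_real]
    push_cast; rfl
  rw [this, sq_abs, freqSq]
  linarith

/-! ### The diagonalizing transform and the interface conditions. -/

/-- The unitary operator that diagonalizes `A_p`. -/
noncomputable def toyTransform {α β : ℝ} (hα : 0 < α) (hβ : 0 < β) : L2R ≃ₗᵢ[ℂ] L2R :=
  (Lp.fourierTransformₗᵢ ℝ ℂ).symm.trans (toyUnitary hα hβ)

theorem coeFn_toyTransform {α β : ℝ} (hα : 0 < α) (hβ : 0 < β) (φ : L2R) :
    toyTransform hα hβ φ =ᵐ[volume] toyMap α β (𝓕⁻ φ : L2R) :=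
  coeFn_toyUnitary hα hβ _

theorem coeFn_toyTransform_of_integrable {α β : ℝ} (hα : 0 < α) (hβ : 0 < β) {φ : L2R}
    (hφ : Integrable φ) : toyTransform hα hβ φ =ᵐ[volume] toyMap α β (expInt φ) :=
  (coeFn_toyTransform hα hβ φ).trans (toyMap_congr_ae hα hβ (coeFn_fourierInv_Lp_two φ hφ))

/-- Coefficient of `F(0)` in the left limit of `u` at `0`; its value is symmetric in `α` and `β`,
hence equals the right one, which gives continuity. -/
theorem inv_mul_rotCos_sub {α β : ℝ} (hα : 0 < α) :
    α⁻¹ * rotCos α β - α⁻¹ * rotSin α β = 2 / √(2 * (α ^ 2 + β ^ 2)) := by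
  unfold rotCos rotSin
  field_simp
  ring

theorem inv_mul_rotCos_add {α β : ℝ} (hβ : 0 < β) :
    β⁻¹ * rotCos α β + β⁻¹ * rotSin α β = 2 / √(2 * (α ^ 2 + β ^ 2)) := by
  unfold rotCos rotSin
  field_simp
  ring

/-- Continuity of the flux `p u'` at `0`. -/
theorem mul_rotCos_add_eq {α β : ℝ} :
    α * (rotCos α β + rotSin α β) = β * (rotCos α β - rotSin α β) := by
  unfold rotCos rotSin
  ring

/-- The easy inclusion: `u` and `p u'` are written as glued primitives built from `F` and `F'`, so
that the interface conditions give their local absolute continuity. -/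
theorem mem_sturmLiouvilleGraph_of_freqSq {α β : ℝ} (hα : 0 < α) (hβ : 0 < β) {φ ψ : L2R}
    (h : ψ =ᵐ[volume] fun ξ => (freqSq ξ : ℂ) * φ ξ) :
    (toyTransform hα hβ φ, toyTransform hα hβ ψ) ∈
      sturmLiouvilleGraph (toyP (α ^ 4) (β ^ 4)) := by
  have hφ := integrable_of_freqSq h
  have hφ' := integrable_deriv_of_freqSq h
  have hF := expInt_isPrimitive hφ hφ'
  have hG := expInt_isPrimitive_Lp hφ' h
  set F := expInt φ with hFdef
  set G := expInt fun ξ : ℝ => (2 * π * ξ * Complex.I) * φ ξ with hGdef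
  have hα2 : α⁻¹ ^ 2 ≠ 0 := by positivity
  have hβ2 : β⁻¹ ^ 2 ≠ 0 := by positivity
  have P1 := (((hF.comp_mul hα2).const_mul ((α⁻¹ * rotCos α β : ℝ) : ℂ)).add
    ((hF.comp_mul (neg_ne_zero.2 hα2)).const_mul ((-(α⁻¹ * rotSin α β) : ℝ) : ℂ))).glue
    (((hF.comp_mul hβ2).const_mul ((β⁻¹ * rotCos α β : ℝ) : ℂ)).add
    ((hF.comp_mul (neg_ne_zero.2 hβ2)).const_mul ((β⁻¹ * rotSin α β : ℝ) : ℂ))) (by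
      simp only [mul_zero]
      rw [← add_mul, ← add_mul, ← Complex.ofReal_add, ← Complex.ofReal_add, inv_mul_rotCos_add hβ,
        ← inv_mul_rotCos_sub hα, sub_eq_add_neg])
  -- The flux: each prefactor is `α⁴ · α⁻¹ · α⁻² = α` (likewise `β`), and the reflected terms change
  -- sign by the chain rule.
  have P2 := (((hG.comp_mul hα2).const_mul ((α * rotCos α β : ℝ) : ℂ)).add
    ((hG.comp_mul (neg_ne_zero.2 hα2)).const_mul ((α * rotSin α β : ℝ) : ℂ))).glue
    (((hG.comp_mul hβ2).const_mul ((β * rotCos α β : ℝ) : ℂ)).add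
    ((hG.comp_mul (neg_ne_zero.2 hβ2)).const_mul ((-(β * rotSin α β) : ℝ) : ℂ))) (by
      simp only [mul_zero]
      rw [← add_mul, ← add_mul, ← Complex.ofReal_add, ← Complex.ofReal_add, ← mul_add,
        mul_rotCos_add_eq, mul_sub, sub_eq_add_neg])
  refine ⟨_, _, P1.locallyAC, P2.locallyAC, ?_, ?_, ?_⟩
  · exact coeFn_toyTransform_of_integrable hα hβ hφ
  · filter_upwards [P1.ae_hasDerivAt] with x hx
    rw [hx.deriv]
    by_cases h0 : x ≤ 0
    · simp only [h0, if_true, toyP]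
      push_cast
      field_simp
    · simp only [h0, if_false, toyP]
      push_cast
      field_simp
  · filter_upwards [P2.ae_hasDerivAt, coeFn_toyTransform hα hβ ψ] with x hx e
    rw [hx.deriv]
    refine e.trans ?_
    unfold toyMap
    by_cases h0 : x ≤ 0
    · simp only [h0, if_true]
      push_cast
      field_simp
      ring
    · simp only [h0, if_false]
      push_cast
      field_simp
      ring

theorem toyP_pos {a b : ℝ} (ha : 0 < a) (hb : 0 < b) (x : ℝ) : 0 < toyP a b x := by
  unfold toyP; split_ifs <;> assumption

/-- For the converse inclusion, an operator `B ⊆ A` with `B + 1` onto and `A + 1` injective equals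
`A`; here `B` is multiplication by `freqSq`. -/
theorem mem_sturmLiouville_graph_iff {α β : ℝ} (hα : 0 < α) (hβ : 0 < β) (φ ψ : L2R) :
    (toyTransform hα hβ φ, toyTransform hα hβ ψ) ∈ (sturmLiouville (toyP (α ^ 4) (β ^ 4))).graph ↔
      ψ =ᵐ[volume] fun ξ => (freqSq ξ : ℂ) * φ ξ := by
  rw [sturmLiouville_graph]
  refine ⟨fun h => ?_, mem_sturmLiouvilleGraph_of_freqSq hα hβ⟩
  set W := toyTransform hα hβ
  have hpos : ∀ ξ, 0 < 1 + freqSq ξ := fun ξ => by have := freqSq_nonneg ξ; positivity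
  have hcont : Continuous fun ξ => (1 + freqSq ξ)⁻¹ :=
    (continuous_const.add continuous_freqSq).inv₀ fun ξ => (hpos ξ).ne'
  have hbdd : ∀ k : ℝ → ℝ, Continuous k → (∀ ξ, 0 ≤ k ξ ∧ k ξ ≤ 1) →
      MemLp (fun ξ => (k ξ : ℂ) * (φ + ψ : L2R) ξ) 2 volume := by
    intro k hk hk1
    refine (Lp.memLp (φ + ψ)).of_le ((Complex.continuous_ofReal.comp hk).aestronglyMeasurable.mul
      (Lp.aestronglyMeasurable _)) (Eventually.of_forall fun ξ => ?_)
    rw [norm_mul, Complex.norm_real, Real.norm_of_nonneg (hk1 ξ).1]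
    exact mul_le_of_le_one_left (norm_nonneg _) (hk1 ξ).2
  -- Solve `(1 + freqSq) φ₀ = φ + ψ` and put `ψ₀ = freqSq · φ₀`; the difference of the two graph
  -- points then has the form `(g, -g)`.
  have m1 := hbdd (fun ξ => (1 + freqSq ξ)⁻¹) hcont fun ξ =>
    ⟨(inv_pos.2 (hpos ξ)).le, inv_le_one_of_one_le₀ (by linarith [freqSq_nonneg ξ])⟩
  have m2 := hbdd (fun ξ => freqSq ξ * (1 + freqSq ξ)⁻¹) (continuous_freqSq.mul hcont) fun ξ => by
    have h1 := freqSq_nonneg ξ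
    have h2 := hpos ξ
    refine ⟨by positivity, ?_⟩
    rw [← div_eq_mul_inv, div_le_one h2]
    linarith
  set φ₀ : L2R := m1.toLp _ with hφ₀
  set ψ₀ : L2R := m2.toLp _ with hψ₀
  have h0 : ψ₀ =ᵐ[volume] fun ξ => (freqSq ξ : ℂ) * φ₀ ξ := by
    filter_upwards [m1.coeFn_toLp, m2.coeFn_toLp] with ξ e1 e2
    rw [hφ₀, hψ₀, e1, e2]
    push_cast
    ring
  have hsum : φ₀ + ψ₀ = φ + ψ := by
    refine Lp.ext ?_
    filter_upwards [m1.coeFn_toLp, m2.coeFn_toLp, Lp.coeFn_add φ₀ ψ₀] with ξ e1 e2 e3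
    have h1 : (1 + freqSq ξ : ℂ) ≠ 0 := by exact_mod_cast (hpos ξ).ne'
    rw [e3, Pi.add_apply, hφ₀, hψ₀, e1, e2]
    push_cast
    field_simp
  have hmem := (sturmLiouvilleGraph _).sub_mem h (mem_sturmLiouvilleGraph_of_freqSq hα hβ h0)
  have hneg : W ψ - W ψ₀ = -(W φ - W φ₀) := by
    rw [← map_sub, ← map_sub, ← map_neg]
    congr 1
    have : ψ = φ₀ + ψ₀ - φ := by rw [hsum]; abel
    rw [this]; abel
  have hz : W φ - W φ₀ = 0 :=
    sturmLiouvilleGraph_neg_eq_zero (toyP_pos (pow_pos hα 4) (pow_pos hβ 4))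
      (by rw [← hneg]; exact hmem)
  have e1 : φ = φ₀ := W.injective (sub_eq_zero.1 hz)
  have e2 : ψ = ψ₀ := by
    rw [hz, neg_zero, sub_eq_zero] at hneg
    exact W.injective hneg
  rw [e1, e2]
  exact h0

theorem mem_paleyWiener_iff {α β Ω : ℝ} (hα : 0 < α) (hβ : 0 < β) (hΩ : 0 < Ω) (φ : L2R) :
    toyTransform hα hβ φ ∈ paleyWiener (sturmLiouville (toyP (α ^ 4) (β ^ 4))) (Icc 0 Ω) ↔
      ∀ᵐ ξ, freqSq ξ ∉ Icc 0 Ω → φ ξ = 0 := by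
  have hE := isSpectralMeasure_multiplicationPVM (toyTransform hα hβ) continuous_freqSq.measurable
    (mem_sturmLiouville_graph_iff hα hβ)
  set W := toyTransform hα hβ
  rw [paleyWiener, hE.spectralProjection_Icc hΩ.le]
  have hS : MeasurableSet (freqSq ⁻¹' Icc 0 Ω) := continuous_freqSq.measurable measurableSet_Icc
  constructor
  · rintro ⟨g, hg⟩
    obtain ⟨χ, rfl⟩ := W.surjective g
    have h1 : W (indicatorCLM volume hS χ) = W φ := by
      rw [← multiplicationPVM_proj W continuous_freqSq.measurable measurableSet_Icc]
      exact hg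
    rw [← W.injective h1]
    filter_upwards [coeFn_indicatorCLM hS χ] with ξ e hξ
    exact e.trans (indicator_of_notMem (s := freqSq ⁻¹' Icc 0 Ω) hξ _)
  · intro h
    refine ⟨W φ, ?_⟩
    have h1 := multiplicationPVM_proj W continuous_freqSq.measurable
      (measurableSet_Icc (a := (0 : ℝ)) (b := Ω)) φ
    refine h1.trans (congrArg W (Lp.ext ?_))
    filter_upwards [coeFn_indicatorCLM hS φ, h] with ξ e hξ
    rw [e]
    by_cases hm : ξ ∈ freqSq ⁻¹' Icc 0 Ω
    · rw [indicator_of_mem hm]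
    · rw [indicator_of_notMem hm, hξ hm]

end SturmLiouville

/-! ### The reproducing kernel -/

section Kernel

open scoped FourierTransform Real

theorem toyMap_integral {X : Type*} [MeasurableSpace X] {μ : Measure X} (α β : ℝ) {g : X → ℝ → ℂ}
    (hg : ∀ t, Integrable (fun ξ => g ξ t) μ) (x : ℝ) :
    toyMap α β (fun t => ∫ ξ, g ξ t ∂μ) x = ∫ ξ, toyMap α β (g ξ) x ∂μ := by
  unfold toyMap
  by_cases hx : x ≤ 0
  · simp only [hx, if_true]
    rw [integral_add ((hg _).const_mul _) ((hg _).const_mul _), integral_const_mul,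
      integral_const_mul]
  · simp only [hx, if_false]
    rw [integral_add ((hg _).const_mul _) ((hg _).const_mul _), integral_const_mul,
      integral_const_mul]

theorem mul_toyMap (α β : ℝ) (c : ℂ) (f : ℝ → ℂ) (x : ℝ) :
    c * toyMap α β f x = toyMap α β (fun t => c * f t) x := by
  unfold toyMap
  split_ifs <;> ring

theorem conj_toyMap (α β : ℝ) (f : ℝ → ℂ) (x : ℝ) :
    (starRingEnd ℂ) (toyMap α β f x) = toyMap α β (fun t => (starRingEnd ℂ) (f t)) x := by
  unfold toyMap
  split_ifs <;> simp only [map_add, map_mul, Complex.conj_ofReal]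

/-- A bound for `toyMap` on functions bounded by `1`. -/
noncomputable def toyBound (α β : ℝ) : ℝ :=
  max (|α⁻¹ * rotCos α β| + |α⁻¹ * rotSin α β|) (|β⁻¹ * rotCos α β| + |β⁻¹ * rotSin α β|)

theorem norm_toyMap_le (α β : ℝ) {f : ℝ → ℂ} (hf : ∀ t, ‖f t‖ ≤ 1) (x : ℝ) :
    ‖toyMap α β f x‖ ≤ toyBound α β := by
  have key : ∀ (a b : ℝ) (s t : ℝ), ‖(a : ℂ) * f s + (b : ℂ) * f t‖ ≤ |a| + |b| := by
    intro a b s t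
    refine (norm_add_le _ _).trans (add_le_add ?_ ?_) <;>
    · rw [norm_mul, Complex.norm_real, Real.norm_eq_abs]
      exact mul_le_of_le_one_right (abs_nonneg _) (hf _)
  unfold toyMap
  split_ifs
  · refine (key _ _ _ _).trans ?_
    rw [abs_neg]
    exact le_max_left _ _
  · exact (key _ _ _ _).trans (le_max_right _ _)

theorem continuous_toyMap {α β : ℝ} (hα : 0 < α) (hβ : 0 < β) {f : ℝ → ℂ} (hf : Continuous f) :
    Continuous (toyMap α β f) := by
  unfold toyMap
  refine Continuous.if_le (by fun_prop) (by fun_prop) continuous_id continuous_const fun x hx => ?_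
  have hx0 : x = 0 := hx
  rw [hx0]
  simp only [mul_zero]
  rw [← add_mul, ← add_mul, ← Complex.ofReal_add, ← Complex.ofReal_add, inv_mul_rotCos_add hβ,
    ← inv_mul_rotCos_sub hα, sub_eq_add_neg]

/-- The generalized eigenfunction `e(x, ξ)` of `A_p` with eigenvalue `(2πξ)²`. -/
noncomputable def toyEigen (α β x ξ : ℝ) : ℂ :=
  toyMap α β (fun t => Complex.exp ((2 * π * ξ * t : ℝ) * Complex.I)) x

theorem continuous_toyEigen (α β x : ℝ) : Continuous (toyEigen α β x) := by
  unfold toyEigen toyMap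
  by_cases hx : x ≤ 0
  · simp only [hx, if_true]; fun_prop
  · simp only [hx, if_false]; fun_prop

theorem norm_toyEigen_le (α β x ξ : ℝ) : ‖toyEigen α β x ξ‖ ≤ toyBound α β :=
  norm_toyMap_le α β (fun _ => (norm_exp_real_mul_I _).le) x

theorem toyMap_expInt (α β : ℝ) {φ : ℝ → ℂ} (hφ : Integrable φ) (x : ℝ) :
    toyMap α β (expInt φ) x = ∫ ξ, φ ξ * toyEigen α β x ξ := by
  unfold expInt
  rw [toyMap_integral α β (fun t => integrable_mul_exp hφ t)]
  simp only [toyEigen, mul_toyMap]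

/-- The frequency band `{ξ : (2πξ)² ≤ Ω}`. -/
def band (Ω : ℝ) : Set ℝ := Icc (-(√Ω / (2 * π))) (√Ω / (2 * π))

theorem measurableSet_band (Ω : ℝ) : MeasurableSet (band Ω) := measurableSet_Icc

theorem volume_band_ne_top (Ω : ℝ) : volume (band Ω) ≠ ⊤ := by simp [band]

theorem freqSq_mem_Icc_iff {Ω : ℝ} (hΩ : 0 < Ω) (ξ : ℝ) : freqSq ξ ∈ Icc 0 Ω ↔ ξ ∈ band Ω := by
  have h2 : (0 : ℝ) < 2 * π := by positivity
  rw [mem_Icc, band, mem_Icc, and_iff_right (freqSq_nonneg ξ), freqSq, Real.sq_le hΩ.le,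
    ← neg_div, div_le_iff₀ h2, le_div_iff₀ h2, mul_comm ξ]

theorem integrable_of_band {Ω : ℝ} {φ : L2R} (h : ∀ᵐ ξ, ξ ∉ band Ω → φ ξ = 0) : Integrable φ := by
  have h1 : IntegrableOn φ (band Ω) :=
    integrableOn_Lp_of_measure_ne_top φ fact_one_le_two_ennreal.elim (volume_band_ne_top Ω)
  refine ((integrable_indicator_iff (measurableSet_band Ω)).2 h1).congr ?_
  filter_upwards [h] with ξ hξ
  by_cases hm : ξ ∈ band Ω
  · rw [indicator_of_mem hm]
  · rw [indicator_of_notMem hm, hξ hm]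

theorem memLp_toyKernelVec (α β Ω x : ℝ) :
    MemLp ((band Ω).indicator fun ξ => (starRingEnd ℂ) (toyEigen α β x ξ)) 2 volume := by
  rw [memLp_indicator_iff_restrict (measurableSet_band Ω)]
  have : IsFiniteMeasure (volume.restrict (band Ω)) :=
    ⟨by rw [Measure.restrict_apply_univ]; exact (volume_band_ne_top Ω).lt_top⟩
  refine MemLp.of_bound (Complex.continuous_conj.comp
    (continuous_toyEigen α β x)).aestronglyMeasurable (toyBound α β)
    (Eventually.of_forall fun ξ => ?_)
  rw [Complex.norm_conj]
  exact norm_toyEigen_le α β x ξ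

/-- The frequency side of the reproducing kernel at `x`. -/
noncomputable def toyKernelVec (α β Ω x : ℝ) : L2R := (memLp_toyKernelVec α β Ω x).toLp _

theorem coeFn_toyKernelVec (α β Ω x : ℝ) : toyKernelVec α β Ω x =ᵐ[volume]
    (band Ω).indicator fun ξ => (starRingEnd ℂ) (toyEigen α β x ξ) :=
  (memLp_toyKernelVec α β Ω x).coeFn_toLp

theorem toyKernelVec_band (α β Ω x : ℝ) : ∀ᵐ ξ, ξ ∉ band Ω → toyKernelVec α β Ω x ξ = 0 := by
  filter_upwards [coeFn_toyKernelVec α β Ω x] with ξ h hξ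
  rw [h, indicator_of_notMem hξ]

/-- The eigenfunctions are bounded uniformly in `x` and `ξ`, and the band has finite measure. This
bound turns norm convergence into uniform convergence. -/
theorem norm_toyKernelVec_le (α β Ω : ℝ) : ∃ M, ∀ x, ‖toyKernelVec α β Ω x‖ ≤ M := by
  refine ⟨toyBound α β * ‖indicatorConstLp 2 (measurableSet_band Ω) (volume_band_ne_top Ω) (1 : ℂ)‖,
    fun x => Lp.norm_le_mul_norm_of_ae_le_mul ?_⟩
  filter_upwards [coeFn_toyKernelVec α β Ω x, indicatorConstLp_coeFn (p := 2)
    (hs := measurableSet_band Ω) (hμs := volume_band_ne_top Ω) (c := (1 : ℂ))] with ξ h1 h2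
  rw [h1, h2]
  by_cases hξ : ξ ∈ band Ω
  · rw [indicator_of_mem hξ, indicator_of_mem hξ, norm_one, mul_one, Complex.norm_conj]
    exact norm_toyEigen_le α β x ξ
  · rw [indicator_of_notMem hξ, indicator_of_notMem hξ, norm_zero, mul_zero]

/-- Point evaluation is the inner product with the kernel vector. -/
theorem toyMap_expInt_eq_inner (α β : ℝ) {Ω : ℝ} {φ : L2R} (h : ∀ᵐ ξ, ξ ∉ band Ω → φ ξ = 0)
    (x : ℝ) : toyMap α β (expInt φ) x = inner ℂ (toyKernelVec α β Ω x) φ := by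
  rw [toyMap_expInt α β (integrable_of_band h), L2.inner_def]
  refine integral_congr_ae ?_
  filter_upwards [h, coeFn_toyKernelVec α β Ω x] with ξ h1 h2
  rw [h2, RCLike.inner_apply]
  by_cases hξ : ξ ∈ band Ω
  · rw [indicator_of_mem hξ, Complex.conj_conj]
  · rw [h1 hξ, zero_mul, zero_mul]

theorem integral_band_exp {Ω : ℝ} (hΩ : 0 < Ω) (t : ℝ) :
    ∫ ξ in band Ω, Complex.exp ((2 * π * ξ * t : ℝ) * Complex.I) =
      ((√Ω / π * Real.sinc (√Ω * t) : ℝ) : ℂ) := by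
  have hB : -(√Ω / (2 * π)) ≤ √Ω / (2 * π) := by
    have : 0 ≤ √Ω / (2 * π) := by positivity
    linarith
  rw [band, integral_Icc_eq_integral_Ioc, ← intervalIntegral.integral_of_le hB]
  by_cases ht : t = 0
  · simp only [ht, mul_zero, Complex.ofReal_zero, zero_mul, Complex.exp_zero, Real.sinc_zero, mul_one]
    rw [intervalIntegral.integral_const, Complex.real_smul]
    push_cast
    field_simp
    ring
  · have h := integral_exp_interval t (-(√Ω / (2 * π))) (√Ω / (2 * π))
    have e : ∀ ξ : ℝ, 2 * π * t * ξ = 2 * π * ξ * t := fun ξ => by ring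
    simp only [e] at h
    have hΩ' : √Ω ≠ 0 := (Real.sqrt_pos.2 hΩ).ne'
    have e1 : 2 * π * (√Ω / (2 * π)) * t = √Ω * t := by field_simp
    have e2 : 2 * π * (-(√Ω / (2 * π))) * t = -(√Ω * t) := by field_simp
    have hc : (2 * π * t * Complex.I : ℂ) ≠ 0 := by simp [ht, Real.pi_ne_zero]
    rw [e1, e2] at h
    refine mul_left_cancel₀ hc (h.trans ?_)
    rw [Real.sinc_of_ne_zero (mul_ne_zero hΩ' ht)]
    push_cast
    rw [Complex.sin]
    have ht' : (t : ℂ) ≠ 0 := by exact_mod_cast ht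
    have hΩ'' : ((√Ω : ℝ) : ℂ) ≠ 0 := by exact_mod_cast hΩ'
    have hπ : (π : ℂ) ≠ 0 := by exact_mod_cast Real.pi_ne_zero
    field_simp
    linear_combination (Complex.exp ((√Ω : ℝ) * t * Complex.I) -
      Complex.exp (-((√Ω : ℝ) * t * Complex.I))) * Complex.I_sq

/-- The coefficients of `toyMap` are real, so conjugating an eigenfunction only conjugates the
exponential; the band integral of `exp(2πiξ(s - t))` is the classical sinc kernel. -/
theorem expInt_toyKernelVec (α β : ℝ) {Ω : ℝ} (hΩ : 0 < Ω) (x s : ℝ) :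
    expInt (toyKernelVec α β Ω x) s =
      toyMap α β (fun t => ((√Ω / π * Real.sinc (√Ω * (s - t)) : ℝ) : ℂ)) x := by
  have h1 : ∀ t, Integrable (fun ξ : ℝ => Complex.exp ((2 * π * ξ * (s - t) : ℝ) * Complex.I))
      (volume.restrict (band Ω)) := fun t =>
    ((by fun_prop : Continuous fun ξ : ℝ =>
      Complex.exp ((2 * π * ξ * (s - t) : ℝ) * Complex.I)).integrableOn_Icc)
  simp only [← integral_band_exp hΩ]
  rw [toyMap_integral α β h1, expInt, ← integral_indicator (measurableSet_band Ω)]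
  refine integral_congr_ae ?_
  filter_upwards [coeFn_toyKernelVec α β Ω x] with ξ e
  rw [e]
  by_cases hξ : ξ ∈ band Ω
  · rw [indicator_of_mem hξ, indicator_of_mem hξ, toyEigen, conj_toyMap, mul_comm, mul_toyMap]
    congr 1
    ext t
    rw [← Complex.exp_conj, ← Complex.exp_add]
    congr 1
    simp only [map_mul, Complex.conj_ofReal, Complex.conj_I]
    push_cast
    ring
  · rw [indicator_of_notMem hξ, indicator_of_notMem hξ, zero_mul]

/-! ### Closed form of the kernel. -/

theorem sqrt_pow_four {α : ℝ} (hα : 0 < α) : √(α ^ 4) = α ^ 2 := by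
  rw [show α ^ 4 = (α ^ 2) ^ 2 by ring, Real.sqrt_sq (by positivity)]

theorem rotCos_sq {α β : ℝ} (hα : 0 < α) (hβ : 0 < β) :
    rotCos α β ^ 2 = (α + β) ^ 2 / (2 * (α ^ 2 + β ^ 2)) := by
  rw [rotCos, div_pow, Real.sq_sqrt (by positivity)]

theorem rotSin_sq {α β : ℝ} (hα : 0 < α) (hβ : 0 < β) :
    rotSin α β ^ 2 = (β - α) ^ 2 / (2 * (α ^ 2 + β ^ 2)) := by
  rw [rotSin, div_pow, Real.sq_sqrt (by positivity)]

theorem rotCos_mul_rotSin {α β : ℝ} (hα : 0 < α) (hβ : 0 < β) :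
    rotCos α β * rotSin α β = (β ^ 2 - α ^ 2) / (2 * (α ^ 2 + β ^ 2)) := by
  rw [rotSin, rotCos, div_mul_div_comm, Real.mul_self_sqrt (by positivity)]
  ring

theorem rotCos_sq_sub_rotSin_sq {α β : ℝ} (hα : 0 < α) (hβ : 0 < β) :
    rotCos α β ^ 2 - rotSin α β ^ 2 = 2 * α * β / (α ^ 2 + β ^ 2) := by
  rw [rotCos_sq hα hβ, rotSin_sq hα hβ]
  field_simp
  ring

/-- Expanding gives four sinc terms, paired up because sinc is even. For points on the same side the
direct terms add to `C² + S² = 1` and the reflected ones to `∓2CS`, minus on the left and plus on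
the right, where `2CS` is the reflection coefficient. For points on opposite sides the reflected
terms cancel and the direct ones leave `C² - S²`, the transmission factor. -/
theorem toyMap_toyMap_sinc {α β Ω : ℝ} (hα : 0 < α) (hβ : 0 < β) (x y : ℝ) :
    toyMap α β (fun s => toyMap α β
      (fun t => ((√Ω / π * Real.sinc (√Ω * (s - t)) : ℝ) : ℂ)) x) y =
      toyKernel (α ^ 4) (β ^ 4) Ω x y := by
  have h1 := rotCos_sq_add_rotSin_sq hα hβ
  have h2 := rotCos_mul_rotSin hα hβ
  have h3 := rotCos_sq_sub_rotSin_sq hα hβ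
  unfold toyKernel toyMap
  rw [sqrt_pow_four hα, sqrt_pow_four hβ]
  set C := rotCos α β
  set S := rotSin α β
  have hneg : ∀ z, Real.sinc (√Ω * (-z)) = Real.sinc (√Ω * z) := fun z => by
    rw [mul_neg, Real.sinc_neg]
  have hπ := Real.pi_ne_zero
  by_cases hx : x ≤ 0 <;> by_cases hy : y ≤ 0 <;> simp only [hx, hy, if_true, if_false]
  · rw [show (x - y) / α ^ 2 = -(α⁻¹ ^ 2 * y - α⁻¹ ^ 2 * x) by field_simp; ring, hneg,
      show -α⁻¹ ^ 2 * y - α⁻¹ ^ 2 * x = -((x + y) / α ^ 2) by field_simp; ring, hneg,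
      show α⁻¹ ^ 2 * y - -α⁻¹ ^ 2 * x = (x + y) / α ^ 2 by field_simp; ring,
      show -α⁻¹ ^ 2 * y - -α⁻¹ ^ 2 * x = -(α⁻¹ ^ 2 * y - α⁻¹ ^ 2 * x) by ring, hneg]
    generalize Real.sinc (√Ω * (α⁻¹ ^ 2 * y - α⁻¹ ^ 2 * x)) = P
    generalize Real.sinc (√Ω * ((x + y) / α ^ 2)) = Q
    norm_cast
    have e : (β ^ 2 - α ^ 2) / (β ^ 2 + α ^ 2) = 2 * (C * S) := by rw [h2]; field_simp; ring
    rw [e]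
    field_simp
    linear_combination √Ω * P * h1
  · rw [show -β⁻¹ ^ 2 * y - -α⁻¹ ^ 2 * x = x / α ^ 2 - y / β ^ 2 by field_simp; ring,
      show β⁻¹ ^ 2 * y - α⁻¹ ^ 2 * x = -(x / α ^ 2 - y / β ^ 2) by field_simp; ring, hneg,
      show -β⁻¹ ^ 2 * y - α⁻¹ ^ 2 * x = -(β⁻¹ ^ 2 * y - -α⁻¹ ^ 2 * x) by ring, hneg]
    generalize Real.sinc (√Ω * (x / α ^ 2 - y / β ^ 2)) = P
    generalize Real.sinc (√Ω * (β⁻¹ ^ 2 * y - -α⁻¹ ^ 2 * x)) = Q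
    norm_cast
    have e : 2 * √Ω / (π * (β ^ 2 + α ^ 2)) = √Ω / π * (α⁻¹ * β⁻¹) * (C ^ 2 - S ^ 2) := by
      rw [h3]; field_simp; ring
    rw [e]
    ring
  · rw [show α⁻¹ ^ 2 * y - β⁻¹ ^ 2 * x = -(x / β ^ 2 - y / α ^ 2) by field_simp; ring, hneg,
      show -α⁻¹ ^ 2 * y - -β⁻¹ ^ 2 * x = x / β ^ 2 - y / α ^ 2 by field_simp; ring,
      show -α⁻¹ ^ 2 * y - β⁻¹ ^ 2 * x = -(α⁻¹ ^ 2 * y - -β⁻¹ ^ 2 * x) by ring, hneg]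
    generalize Real.sinc (√Ω * (x / β ^ 2 - y / α ^ 2)) = P
    generalize Real.sinc (√Ω * (α⁻¹ ^ 2 * y - -β⁻¹ ^ 2 * x)) = Q
    norm_cast
    have e : 2 * √Ω / (π * (β ^ 2 + α ^ 2)) = √Ω / π * (α⁻¹ * β⁻¹) * (C ^ 2 - S ^ 2) := by
      rw [h3]; field_simp; ring
    rw [e]
    ring
  · rw [show (x - y) / β ^ 2 = -(β⁻¹ ^ 2 * y - β⁻¹ ^ 2 * x) by field_simp; ring, hneg,
      show -β⁻¹ ^ 2 * y - β⁻¹ ^ 2 * x = -((x + y) / β ^ 2) by field_simp; ring, hneg,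
      show β⁻¹ ^ 2 * y - -β⁻¹ ^ 2 * x = (x + y) / β ^ 2 by field_simp; ring,
      show -β⁻¹ ^ 2 * y - -β⁻¹ ^ 2 * x = -(β⁻¹ ^ 2 * y - β⁻¹ ^ 2 * x) by ring, hneg]
    generalize Real.sinc (√Ω * (β⁻¹ ^ 2 * y - β⁻¹ ^ 2 * x)) = P
    generalize Real.sinc (√Ω * ((x + y) / β ^ 2)) = Q
    norm_cast
    have e : (β ^ 2 - α ^ 2) / (β ^ 2 + α ^ 2) = 2 * (C * S) := by rw [h2]; field_simp; ring
    rw [e]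
    field_simp
    linear_combination √Ω * P * h1

theorem toyMap_expInt_toyKernelVec {α β Ω : ℝ} (hα : 0 < α) (hβ : 0 < β) (hΩ : 0 < Ω) (x y : ℝ) :
    toyMap α β (expInt (toyKernelVec α β Ω x)) y = toyKernel (α ^ 4) (β ^ 4) Ω x y := by
  rw [← toyMap_toyMap_sinc hα hβ]
  congr 1
  ext s
  exact expInt_toyKernelVec α β hΩ x s

end Kernel

/-! ### The sampling points -/

section Sampling

open scoped FourierTransform Real

theorem sinc_pi_mul_int (n : ℤ) : Real.sinc (π * n) = if n = 0 then 1 else 0 := by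
  split_ifs with h
  · simp [h]
  · rw [Real.sinc_of_ne_zero (mul_ne_zero Real.pi_ne_zero (by exact_mod_cast h)), mul_comm π,
      Real.sin_int_mul_pi, zero_div]

theorem toyPoint_of_nonpos {a b Ω : ℝ} {j : ℤ} (hj : j ≤ 0) :
    toyPoint a b Ω j = π * j * √a / √Ω := by
  have : (j : ℝ) ≤ 0 := by exact_mod_cast hj
  rw [toyPoint, toyP, if_pos this]

theorem toyPoint_of_pos {a b Ω : ℝ} {j : ℤ} (hj : 0 < j) :
    toyPoint a b Ω j = π * j * √b / √Ω := by
  have : ¬ (j : ℝ) ≤ 0 := by rw [not_le]; exact_mod_cast hj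
  rw [toyPoint, toyP, if_neg this]

theorem toyPoint_nonpos_iff {a b Ω : ℝ} (ha : 0 < a) (hb : 0 < b) (hΩ : 0 < Ω) (j : ℤ) :
    toyPoint a b Ω j ≤ 0 ↔ j ≤ 0 := by
  have h1 : 0 < π * (√(toyP a b j) / √Ω) := by
    have := Real.sqrt_pos.2 (toyP_pos ha hb j)
    positivity
  rw [show toyPoint a b Ω j = π * (√(toyP a b j) / √Ω) * j by unfold toyPoint; ring,
    ← not_lt, mul_pos_iff_of_pos_left h1, not_lt]
  exact_mod_cast Iff.rfl

theorem toyWeight_pos {a b : ℝ} (ha : 0 < a) (hb : 0 < b) (j : ℤ) : 0 < toyWeight a b j := by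
  unfold toyWeight; split_ifs <;> positivity

/-- Measured in the travel time `x / √p`, the points are `πj/√Ω` on both sides, so the sinc
arguments are `π (i - j)` and `π (i + j)`. -/
theorem toyKernel_toyPoint {a b Ω : ℝ} (ha : 0 < a) (hb : 0 < b) (hΩ : 0 < Ω) (i j : ℤ) :
    toyKernel a b Ω (toyPoint a b Ω i) (toyPoint a b Ω j) =
      if i = j then ((√Ω / (π * toyWeight a b j) : ℝ) : ℂ) else 0 := by
  have ha' := Real.sqrt_pos.2 ha
  have hb' := Real.sqrt_pos.2 hb
  have hΩ' := Real.sqrt_pos.2 hΩ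
  have hπ := Real.pi_pos
  have hs : ∀ {c : ℝ}, 0 < √c → √Ω * ((π * i * √c / √Ω - π * j * √c / √Ω) / √c) = π * (i - j : ℤ) := by
    intro c hc
    push_cast
    field_simp
  have hp : ∀ {c : ℝ}, 0 < √c → √Ω * ((π * i * √c / √Ω + π * j * √c / √Ω) / √c) = π * (i + j : ℤ) := by
    intro c hc
    push_cast
    field_simp
  have hm : ∀ {c d : ℝ}, 0 < √c → 0 < √d →
      √Ω * (π * i * √c / √Ω / √c - π * j * √d / √Ω / √d) = π * (i - j : ℤ) := by
    intro c d hc hd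
    push_cast
    field_simp
  have hR : (if i = j then ((√Ω / (π * toyWeight a b j) : ℝ) : ℂ) else 0) =
      ((if i = j then √Ω / (π * toyWeight a b j) else 0 : ℝ) : ℂ) := by split_ifs <;> simp
  rw [hR, toyKernel]
  congr 1
  simp only [toyPoint_nonpos_iff ha hb hΩ]
  by_cases hi : i ≤ 0 <;> by_cases hj : j ≤ 0 <;> simp only [hi, hj, if_true, if_false]
  · rw [toyPoint_of_nonpos hi, toyPoint_of_nonpos hj, hs ha', hp ha', sinc_pi_mul_int,
      sinc_pi_mul_int]
    by_cases hij : i = j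
    · subst hij
      simp only [sub_self, if_true]
      rcases hi.lt_or_eq with hlt | h0
      · rw [if_neg (by omega), toyWeight, if_pos hlt]
        ring
      -- Only at `i = j = 0` does the reflected term survive; it changes the factor `1/√a` into
      -- `2/(√a + √b)`, which is why the weight at `0` is the mean.
      · subst h0
        simp only [add_zero, if_true, toyWeight, lt_irrefl, if_false]
        field_simp
        ring
    · rw [if_neg (by omega), if_neg (by omega), if_neg hij]
      ring
  · rw [toyPoint_of_nonpos hi, toyPoint_of_pos (not_le.1 hj), hm ha' hb', sinc_pi_mul_int,
      if_neg (by omega), if_neg (by omega), mul_zero]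
  · rw [toyPoint_of_nonpos hj, toyPoint_of_pos (not_le.1 hi), hm hb' ha', sinc_pi_mul_int,
      if_neg (by omega), if_neg (by omega), mul_zero]
  · rw [toyPoint_of_pos (not_le.1 hi), toyPoint_of_pos (not_le.1 hj), hs hb', hp hb',
      sinc_pi_mul_int, sinc_pi_mul_int, if_neg (show ¬ i + j = 0 by omega)]
    by_cases hij : i = j
    · subst hij
      rw [if_pos (sub_self i), if_pos rfl, toyWeight, if_neg (by omega), if_pos (by omega)]
      ring
    · rw [if_neg (by omega), if_neg hij]
      ring

/-- The band has length `√Ω/π`, the reciprocal of the sample spacing, so the samples are, up to a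
factor and a sign of the index, the Fourier coefficients of `φ` on the band; Parseval concludes. -/
theorem eq_zero_of_expInt_eq_zero {Ω : ℝ} (hΩ : 0 < Ω) {φ : L2R}
    (h : ∀ᵐ ξ, ξ ∉ band Ω → φ ξ = 0) (h0 : ∀ n : ℤ, expInt φ (π * n / √Ω) = 0) : φ = 0 := by
  set B := √Ω / (2 * π) with hB
  have hΩ' := Real.sqrt_pos.2 hΩ
  have hBpos : 0 < B := by positivity
  have hab : -B < B := by linarith
  have hcoeff : ∀ n, fourierCoeffOn hab φ n = 0 := by
    intro n
    rw [fourierCoeffOn_eq_integral]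
    have : ∫ ξ in (-B)..B, fourier (-n) (ξ : AddCircle (B - -B)) • φ ξ =
        expInt φ (π * (-n : ℤ) / √Ω) := by
      rw [intervalIntegral.integral_of_le hab.le, ← integral_Icc_eq_integral_Ioc,
        ← integral_indicator measurableSet_Icc, expInt]
      refine integral_congr_ae ?_
      filter_upwards [h] with ξ hξ
      by_cases hm : ξ ∈ Icc (-B) B
      · rw [indicator_of_mem hm, fourier_coe_apply, smul_eq_mul, mul_comm]
        congr 2
        have hπ : (π : ℂ) ≠ 0 := by exact_mod_cast Real.pi_ne_zero
        have hΩ'' : ((√Ω : ℝ) : ℂ) ≠ 0 := by exact_mod_cast hΩ'.ne'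
        rw [hB]
        push_cast
        field_simp
        ring
      · rw [indicator_of_notMem hm, hξ hm, zero_mul]
    rw [this, h0, smul_zero]
  have hP := hasSum_sq_fourierCoeffOn hab ((Lp.memLp φ).restrict _)
  simp only [hcoeff, norm_zero, zero_pow two_ne_zero] at hP
  have h1 := hP.unique hasSum_zero
  have h2 : ∫ ξ in (-B)..B, ‖φ ξ‖ ^ 2 = 0 := by
    rw [smul_eq_mul, mul_eq_zero] at h1
    rcases h1 with h1 | h1
    · exact absurd h1 (inv_pos.2 (by linarith)).ne'
    · exact h1
  rw [intervalIntegral.integral_of_le hab.le, ← integral_Icc_eq_integral_Ioc] at h2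
  have h3 : ‖φ‖ ^ 2 = 0 := by
    rw [norm_sq_Lp_two, ← h2, ← integral_indicator measurableSet_Icc]
    refine integral_congr_ae ?_
    filter_upwards [h] with ξ hξ
    by_cases hm : ξ ∈ Icc (-B) B
    · rw [indicator_of_mem hm]
    · rw [indicator_of_notMem hm, hξ hm]
      simp
  simpa using h3

/-- For `n > 0` the samples at `x_n` and `x_{-n}` give a two by two system for `F(±πn/√Ω)` whose
matrix is a rotation up to row scaling, so the classical samples vanish too. -/
theorem eq_zero_of_samples {α β Ω : ℝ} (hα : 0 < α) (hβ : 0 < β) (hΩ : 0 < Ω) {φ : L2R}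
    (h : ∀ᵐ ξ, ξ ∉ band Ω → φ ξ = 0)
    (h0 : ∀ j : ℤ, toyMap α β (expInt φ) (toyPoint (α ^ 4) (β ^ 4) Ω j) = 0) : φ = 0 := by
  refine eq_zero_of_expInt_eq_zero hΩ h ?_
  set F := expInt φ
  have hΩ' := Real.sqrt_pos.2 hΩ
  have e1 : ∀ j : ℤ, j ≤ 0 → (rotCos α β : ℂ) * F (π * j / √Ω) -
      (rotSin α β : ℂ) * F (π * (-j : ℤ) / √Ω) = 0 := by
    intro j hj
    have h1 := h0 j
    have hj' := (toyPoint_nonpos_iff (pow_pos hα 4) (pow_pos hβ 4) hΩ j).2 hj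
    rw [toyMap, if_pos hj', toyPoint_of_nonpos hj, sqrt_pow_four hα,
      show α⁻¹ ^ 2 * (π * j * α ^ 2 / √Ω) = π * j / √Ω by field_simp,
      show -α⁻¹ ^ 2 * (π * j * α ^ 2 / √Ω) = π * (-j : ℤ) / √Ω by push_cast; field_simp] at h1
    have hα' : ((α⁻¹ : ℝ) : ℂ) ≠ 0 := by exact_mod_cast inv_ne_zero hα.ne'
    refine mul_left_cancel₀ hα' ?_
    rw [mul_zero, ← h1]
    push_cast
    ring
  have e2 : ∀ j : ℤ, 0 < j → (rotCos α β : ℂ) * F (π * j / √Ω) +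
      (rotSin α β : ℂ) * F (π * (-j : ℤ) / √Ω) = 0 := by
    intro j hj
    have h1 := h0 j
    have hj' := mt (toyPoint_nonpos_iff (pow_pos hα 4) (pow_pos hβ 4) hΩ j).1 (not_le.2 hj)
    rw [toyMap, if_neg hj', toyPoint_of_pos hj, sqrt_pow_four hβ,
      show β⁻¹ ^ 2 * (π * j * β ^ 2 / √Ω) = π * j / √Ω by field_simp,
      show -β⁻¹ ^ 2 * (π * j * β ^ 2 / √Ω) = π * (-j : ℤ) / √Ω by push_cast; field_simp] at h1
    have hβ' : ((β⁻¹ : ℝ) : ℂ) ≠ 0 := by exact_mod_cast inv_ne_zero hβ.ne'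
    refine mul_left_cancel₀ hβ' ?_
    rw [mul_zero, ← h1]
    push_cast
    ring
  have hdet : (rotCos α β : ℂ) ^ 2 + (rotSin α β : ℂ) ^ 2 = 1 := by
    exact_mod_cast rotCos_sq_add_rotSin_sq hα hβ
  have hpos : ∀ n : ℤ, 0 < n → F (π * n / √Ω) = 0 ∧ F (π * (-n : ℤ) / √Ω) = 0 := by
    intro n hn
    have k1 := e1 (-n) (by omega)
    have k2 := e2 n hn
    rw [neg_neg] at k1
    constructor
    · linear_combination (rotCos α β : ℂ) * k2 - (rotSin α β : ℂ) * k1 - F (π * n / √Ω) * hdet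
    · linear_combination (rotSin α β : ℂ) * k2 + (rotCos α β : ℂ) * k1 -
        F (π * (-n : ℤ) / √Ω) * hdet
  intro n
  rcases lt_trichotomy n 0 with hn | hn | hn
  · have := (hpos (-n) (by omega)).2
    rwa [neg_neg] at this
  · subst hn
    -- At `0` there is a single equation `(C - S) F(0) = 0`, and `C - S` is positive.
    have k := e1 0 le_rfl
    rw [neg_zero, ← sub_mul] at k
    refine (mul_eq_zero.1 k).resolve_left ?_
    rw [← Complex.ofReal_sub, Complex.ofReal_eq_zero]
    have h2 : rotCos α β - rotSin α β = 2 * α / √(2 * (α ^ 2 + β ^ 2)) := by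
      unfold rotCos rotSin; ring
    rw [h2]
    exact ne_of_gt (by positivity)
  · exact (hpos n hn).1

/-! ### The Paley–Wiener space -/

/-- The Paley–Wiener space of the toy operator. -/
noncomputable abbrev toyPW (α β Ω : ℝ) : Submodule ℂ L2R :=
  paleyWiener (sturmLiouville (toyP (α ^ 4) (β ^ 4))) (Icc 0 Ω)

theorem mem_toyPW_iff {α β Ω : ℝ} (hα : 0 < α) (hβ : 0 < β) (hΩ : 0 < Ω) (φ : L2R) :
    toyTransform hα hβ φ ∈ toyPW α β Ω ↔ ∀ᵐ ξ, ξ ∉ band Ω → φ ξ = 0 := by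
  rw [toyPW, mem_paleyWiener_iff hα hβ hΩ]
  simp only [freqSq_mem_Icc_iff hΩ]

/-- Supplies the completeness required to build a Hilbert basis of the subspace. -/
theorem isClosed_paleyWiener {H : Type*} [NormedAddCommGroup H] [InnerProductSpace ℂ H]
    [CompleteSpace H] (A : H →ₗ.[ℂ] H) (s : Set ℝ) : IsClosed (paleyWiener A s : Set H) := by
  have h : IsIdempotentElem (spectralProjection A s) := by
    unfold spectralProjection
    split_ifs with h
    · exact (h.choose.isStarProjection s).isIdempotentElem
    · exact IsIdempotentElem.zero
  exact ContinuousLinearMap.IsIdempotentElem.isClosed_range h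

theorem coeFn_toyTransform_of_band {α β Ω : ℝ} (hα : 0 < α) (hβ : 0 < β) {φ : L2R}
    (h : ∀ᵐ ξ, ξ ∉ band Ω → φ ξ = 0) :
    toyTransform hα hβ φ =ᵐ[volume] toyMap α β (expInt φ) :=
  coeFn_toyTransform_of_integrable hα hβ (integrable_of_band h)

theorem continuous_toyMap_expInt {α β Ω : ℝ} (hα : 0 < α) (hβ : 0 < β) {φ : L2R}
    (h : ∀ᵐ ξ, ξ ∉ band Ω → φ ξ = 0) : Continuous (toyMap α β (expInt φ)) :=
  continuous_toyMap hα hβ (continuous_expInt (integrable_of_band h))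

/-- Continuous functions that agree almost everywhere agree everywhere, so the given representative
is the explicit one and point values may be computed from the spectrum. -/
theorem exists_of_mem_continuousElements {α β Ω : ℝ} (hα : 0 < α) (hβ : 0 < β) (hΩ : 0 < Ω)
    {u : ℝ → ℂ} (hu : u ∈ continuousElements (toyPW α β Ω)) :
    ∃ φ : L2R, (∀ᵐ ξ, ξ ∉ band Ω → φ ξ = 0) ∧ u = toyMap α β (expInt φ) := by
  obtain ⟨huc, f, hf, hfu⟩ := hu
  obtain ⟨φ, rfl⟩ := (toyTransform hα hβ).surjective f
  have hφ := (mem_toyPW_iff hα hβ hΩ φ).1 hf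
  exact ⟨φ, hφ, Measure.eq_of_ae_eq (μ := volume)
    (hfu.symm.trans (coeFn_toyTransform_of_band hα hβ hφ)) huc (continuous_toyMap_expInt hα hβ hφ)⟩

theorem coeFn_toyTransform_toyKernelVec {α β Ω : ℝ} (hα : 0 < α) (hβ : 0 < β) (hΩ : 0 < Ω) (x : ℝ) :
    toyTransform hα hβ (toyKernelVec α β Ω x) =ᵐ[volume] toyKernel (α ^ 4) (β ^ 4) Ω x := by
  refine (coeFn_toyTransform_of_band hα hβ (toyKernelVec_band α β Ω x)).trans ?_
  exact Eventually.of_forall (toyMap_expInt_toyKernelVec hα hβ hΩ x)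

theorem inner_toyKernelVec {α β Ω : ℝ} (hα : 0 < α) (hβ : 0 < β) (hΩ : 0 < Ω) (x y : ℝ) :
    inner ℂ (toyKernelVec α β Ω x) (toyKernelVec α β Ω y) = toyKernel (α ^ 4) (β ^ 4) Ω y x := by
  rw [← toyMap_expInt_eq_inner α β (toyKernelVec_band α β Ω y), toyMap_expInt_toyKernelVec hα hβ hΩ]

theorem isReproducingKernel_toyKernel {α β Ω : ℝ} (hα : 0 < α) (hβ : 0 < β) (hΩ : 0 < Ω) :
    IsReproducingKernel (toyPW α β Ω) (toyKernel (α ^ 4) (β ^ 4) Ω) where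
  exists_continuous f hf := by
    obtain ⟨φ, rfl⟩ := (toyTransform hα hβ).surjective f
    have hφ := (mem_toyPW_iff hα hβ hΩ φ).1 hf
    exact ⟨_, continuous_toyMap_expInt hα hβ hφ, coeFn_toyTransform_of_band hα hβ hφ⟩
  kernel_mem x := by
    have hb := toyKernelVec_band α β Ω x
    refine ⟨?_, toyTransform hα hβ (toyKernelVec α β Ω x), (mem_toyPW_iff hα hβ hΩ _).2 hb,
      coeFn_toyTransform_toyKernelVec hα hβ hΩ x⟩
    rw [← funext (toyMap_expInt_toyKernelVec hα hβ hΩ x)]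
    exact continuous_toyMap_expInt hα hβ hb
  reproducing u hu x := by
    obtain ⟨φ, hφ, rfl⟩ := exists_of_mem_continuousElements hα hβ hΩ hu
    rw [toyMap_expInt_eq_inner α β hφ, ← (toyTransform hα hβ).inner_map_map, L2.inner_def]
    refine integral_congr_ae ?_
    filter_upwards [coeFn_toyTransform_of_band hα hβ hφ,
      coeFn_toyTransform_toyKernelVec hα hβ hΩ x] with y e1 e2
    rw [e1, e2, RCLike.inner_apply]

/-- The normalized kernels at the sampling points. -/
noncomputable def toySampleVec {α β Ω : ℝ} (hα : 0 < α) (hβ : 0 < β) (hΩ : 0 < Ω) (j : ℤ) :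
    toyPW α β Ω :=
  ⟨toyTransform hα hβ ((√(π * toyWeight (α ^ 4) (β ^ 4) j / √Ω) : ℂ) •
      toyKernelVec α β Ω (toyPoint (α ^ 4) (β ^ 4) Ω j)), by
    rw [map_smul]
    exact Submodule.smul_mem _ _ ((mem_toyPW_iff hα hβ hΩ _).2 (toyKernelVec_band _ _ _ _))⟩

theorem orthonormal_toySampleVec {α β Ω : ℝ} (hα : 0 < α) (hβ : 0 < β) (hΩ : 0 < Ω) :
    Orthonormal ℂ (toySampleVec hα hβ hΩ) := by
  rw [orthonormal_iff_ite]
  intro i j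
  rw [Submodule.coe_inner]
  simp only [toySampleVec]
  rw [LinearIsometryEquiv.inner_map_map, inner_smul_left, inner_smul_right,
    inner_toyKernelVec hα hβ hΩ, toyKernel_toyPoint (pow_pos hα 4) (pow_pos hβ 4) hΩ,
    Complex.conj_ofReal]
  by_cases hij : i = j
  · subst hij
    rw [if_pos rfl, if_pos rfl, ← mul_assoc]
    norm_cast
    have hw := toyWeight_pos (pow_pos hα 4) (pow_pos hβ 4) i
    have hΩ' := Real.sqrt_pos.2 hΩ
    rw [Real.mul_self_sqrt (by positivity)]
    field_simp
  · rw [if_neg hij, if_neg (Ne.symm hij), mul_zero, mul_zero]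

/-- By the reproducing property, orthogonality to a normalized kernel means that the sample at its
point vanishes, and the samples determine the function. -/
theorem orthogonal_span_toySampleVec {α β Ω : ℝ} (hα : 0 < α) (hβ : 0 < β) (hΩ : 0 < Ω) :
    (Submodule.span ℂ (range (toySampleVec hα hβ hΩ)))ᗮ = ⊥ := by
  rw [Submodule.eq_bot_iff]
  intro f hf
  obtain ⟨f, hfV⟩ := f
  obtain ⟨φ, rfl⟩ := (toyTransform hα hβ).surjective f
  have hφ := (mem_toyPW_iff hα hβ hΩ φ).1 hfV
  have h0 : φ = 0 := by
    refine eq_zero_of_samples hα hβ hΩ hφ fun j => ?_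
    have h1 := (Submodule.mem_orthogonal _ _).1 hf (toySampleVec hα hβ hΩ j)
      (Submodule.subset_span ⟨j, rfl⟩)
    rw [Submodule.coe_inner] at h1
    simp only [toySampleVec] at h1
    rw [LinearIsometryEquiv.inner_map_map, inner_smul_left,
      ← toyMap_expInt_eq_inner α β hφ] at h1
    refine (mul_eq_zero.1 h1).resolve_left ?_
    have hw := toyWeight_pos (pow_pos hα 4) (pow_pos hβ 4) j
    have hΩ' := Real.sqrt_pos.2 hΩ
    rw [Complex.conj_ofReal, Complex.ofReal_eq_zero]
    exact ne_of_gt (by positivity)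
  ext1
  simp [h0]

/-- The orthonormal basis of normalized kernels at the sampling points. -/
noncomputable def toyBasis {α β Ω : ℝ} (hα : 0 < α) (hβ : 0 < β) (hΩ : 0 < Ω) :
    HilbertBasis ℤ ℂ (toyPW α β Ω) :=
  haveI : CompleteSpace (toyPW α β Ω) := (isClosed_paleyWiener _ _).completeSpace_coe
  HilbertBasis.mkOfOrthogonalEqBot (orthonormal_toySampleVec hα hβ hΩ)
    (orthogonal_span_toySampleVec hα hβ hΩ)

theorem toyBasis_apply {α β Ω : ℝ} (hα : 0 < α) (hβ : 0 < β) (hΩ : 0 < Ω) (j : ℤ) :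
    toyBasis hα hβ hΩ j = toySampleVec hα hβ hΩ j := by
  have : CompleteSpace (toyPW α β Ω) := (isClosed_paleyWiener _ _).completeSpace_coe
  exact congrFun (HilbertBasis.coe_mkOfOrthogonalEqBot (orthonormal_toySampleVec hα hβ hΩ)
    (orthogonal_span_toySampleVec hα hβ hΩ)) j

/-- The basis expansion pulled back to the frequency side. The normalization enters once in the
coefficient and once in the basis vector, producing the factor `π w_j / √Ω`. -/
theorem hasSum_toyKernelVec {α β Ω : ℝ} (hα : 0 < α) (hβ : 0 < β) (hΩ : 0 < Ω) {φ : L2R}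
    (hφ : ∀ᵐ ξ, ξ ∉ band Ω → φ ξ = 0) :
    HasSum (fun j : ℤ => ((π / √Ω : ℂ) * ((toyWeight (α ^ 4) (β ^ 4) j : ℂ) *
      toyMap α β (expInt φ) (toyPoint (α ^ 4) (β ^ 4) Ω j))) •
        toyKernelVec α β Ω (toyPoint (α ^ 4) (β ^ 4) Ω j)) φ := by
  have h := (toyBasis hα hβ hΩ).hasSum_repr ⟨_, (mem_toyPW_iff hα hβ hΩ φ).2 hφ⟩
  have h1 := ((toyTransform hα hβ).symm.toContinuousLinearEquiv : L2R →L[ℂ] L2R).hasSum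
    ((toyPW α β Ω).subtypeL.hasSum h)
  convert! h1 using 1
  · ext1 j
    rw [HilbertBasis.repr_apply_apply, toyBasis_apply, Submodule.coe_inner]
    simp only [toySampleVec]
    rw [LinearIsometryEquiv.inner_map_map, inner_smul_left, ← toyMap_expInt_eq_inner α β hφ,
      Complex.conj_ofReal]
    have hw := toyWeight_pos (pow_pos hα 4) (pow_pos hβ 4) j
    have hΩ' := Real.sqrt_pos.2 hΩ
    have hsq : ((√(π * toyWeight (α ^ 4) (β ^ 4) j / √Ω) : ℝ) : ℂ) *
        ((√(π * toyWeight (α ^ 4) (β ^ 4) j / √Ω) : ℝ) : ℂ) =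
        (π / √Ω : ℂ) * (toyWeight (α ^ 4) (β ^ 4) j : ℂ) := by
      rw [← Complex.ofReal_mul, Real.mul_self_sqrt (by positivity)]
      push_cast
      ring
    simp only [map_smul, Submodule.subtypeL_apply, ContinuousLinearEquiv.coe_coe,
      LinearIsometryEquiv.coe_toContinuousLinearEquiv, LinearIsometryEquiv.symm_apply_apply,
      smul_smul]
    congr 1
    rw [mul_right_comm, hsq]
    ring
  · simp

end Sampling

/-! ### The sampling theorem. -/

theorem mainTheorem5 (pm pp Ω : ℝ) (hpm : 0 < pm) (hpp : 0 < pp) (hΩ : 0 < Ω) :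
    -- `k` is the reproducing kernel of `PW_{[0,Ω]}(A_p)`
    IsReproducingKernel (paleyWiener (sturmLiouville (toyP pm pp)) (Icc 0 Ω))
      (toyKernel pm pp Ω) ∧
    -- the normalized kernels at the points `x_j` form an orthonormal basis
    (∃ b : HilbertBasis ℤ ℂ (paleyWiener (sturmLiouville (toyP pm pp)) (Icc 0 Ω)),
      ∀ j : ℤ, ((b j : L2R) : ℝ → ℂ) =ᵐ[volume] fun y =>
        (√(Real.pi * toyWeight pm pp j / √Ω) : ℂ) *
          toyKernel pm pp Ω (toyPoint pm pp Ω j) y) ∧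
    -- the cardinal series converges to `u` in `L²` and uniformly
    ∀ u ∈ continuousElements (paleyWiener (sturmLiouville (toyP pm pp)) (Icc 0 Ω)),
      Tendsto (fun s : Finset ℤ => eLpNorm (fun x => u x - (Real.pi / √Ω : ℂ) *
          ∑ j ∈ s, (toyWeight pm pp j : ℂ) * u (toyPoint pm pp Ω j) *
            toyKernel pm pp Ω (toyPoint pm pp Ω j) x) 2 volume) atTop (𝓝 0) ∧
      TendstoUniformly (fun (s : Finset ℤ) (x : ℝ) => (Real.pi / √Ω : ℂ) *
          ∑ j ∈ s, (toyWeight pm pp j : ℂ) * u (toyPoint pm pp Ω j) *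
            toyKernel pm pp Ω (toyPoint pm pp Ω j) x) u atTop := by
  -- Fourth roots remove all radicals: the dilation rate is `√p = α²` and its unitary weight
  -- involves `α`.
  obtain ⟨α, hα, rfl⟩ : ∃ α : ℝ, 0 < α ∧ pm = α ^ 4 := ⟨√√pm, by positivity, by
    rw [show √√pm ^ 4 = (√√pm ^ 2) ^ 2 by ring, Real.sq_sqrt (by positivity),
      Real.sq_sqrt hpm.le]⟩
  obtain ⟨β, hβ, rfl⟩ : ∃ β : ℝ, 0 < β ∧ pp = β ^ 4 := ⟨√√pp, by positivity, by
    rw [show √√pp ^ 4 = (√√pp ^ 2) ^ 2 by ring, Real.sq_sqrt (by positivity),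
      Real.sq_sqrt hpp.le]⟩
  refine ⟨isReproducingKernel_toyKernel hα hβ hΩ, ⟨toyBasis hα hβ hΩ, fun j => ?_⟩, fun u hu => ?_⟩
  · rw [toyBasis_apply]
    simp only [toySampleVec, map_smul]
    refine (Lp.coeFn_smul _ _).trans ?_
    filter_upwards [coeFn_toyTransform_toyKernelVec hα hβ hΩ (toyPoint (α ^ 4) (β ^ 4) Ω j)]
      with y e
    rw [Pi.smul_apply, e, smul_eq_mul]
  obtain ⟨φ, hφ, rfl⟩ := exists_of_mem_continuousElements hα hβ hΩ hu
  have hsum := hasSum_toyKernelVec hα hβ hΩ hφ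
  set c : ℤ → ℂ := fun j => (Real.pi / √Ω : ℂ) * ((toyWeight (α ^ 4) (β ^ 4) j : ℂ) *
      toyMap α β (expInt φ) (toyPoint (α ^ 4) (β ^ 4) Ω j)) with hc
  set κ : ℤ → L2R := fun j => toyKernelVec α β Ω (toyPoint (α ^ 4) (β ^ 4) Ω j) with hκ
  have hnorm : Tendsto (fun s : Finset ℤ => ‖φ - ∑ j ∈ s, c j • κ j‖) atTop (𝓝 0) := by
    have := (tendsto_const_nhds (x := φ)).sub hsum
    rw [sub_self] at this
    exact tendsto_zero_iff_norm_tendsto_zero.1 this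
  have hband : ∀ s : Finset ℤ, ∀ᵐ ξ, ξ ∉ band Ω → (φ - ∑ j ∈ s, c j • κ j : L2R) ξ = 0 := by
    intro s
    rw [← mem_toyPW_iff hα hβ hΩ, map_sub, map_sum]
    refine Submodule.sub_mem _ ((mem_toyPW_iff hα hβ hΩ φ).2 hφ) (Submodule.sum_mem _ fun j _ => ?_)
    rw [map_smul]
    exact Submodule.smul_mem _ _ ((mem_toyPW_iff hα hβ hΩ _).2 (toyKernelVec_band _ _ _ _))
  -- The pointwise error is the kernel vector at `x` paired with the error of the frequency-side
  -- expansion. Both convergence claims follow from it: the first by unitarity of `W`, the second by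
  -- Cauchy–Schwarz with a bound independent of `x`.
  have heval : ∀ (s : Finset ℤ) (x : ℝ), toyMap α β (expInt φ) x - (Real.pi / √Ω : ℂ) *
      ∑ j ∈ s, (toyWeight (α ^ 4) (β ^ 4) j : ℂ) *
        toyMap α β (expInt φ) (toyPoint (α ^ 4) (β ^ 4) Ω j) *
          toyKernel (α ^ 4) (β ^ 4) Ω (toyPoint (α ^ 4) (β ^ 4) Ω j) x =
      inner ℂ (toyKernelVec α β Ω x) (φ - ∑ j ∈ s, c j • κ j) := by
    intro s x
    rw [inner_sub_right, ← toyMap_expInt_eq_inner α β hφ, inner_sum, Finset.mul_sum]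
    congr 1
    refine Finset.sum_congr rfl fun j _ => ?_
    rw [inner_smul_right, inner_toyKernelVec hα hβ hΩ, hc]
    ring
  constructor
  · have h1 : ∀ s : Finset ℤ, eLpNorm (fun x => toyMap α β (expInt φ) x - (Real.pi / √Ω : ℂ) *
        ∑ j ∈ s, (toyWeight (α ^ 4) (β ^ 4) j : ℂ) *
          toyMap α β (expInt φ) (toyPoint (α ^ 4) (β ^ 4) Ω j) *
            toyKernel (α ^ 4) (β ^ 4) Ω (toyPoint (α ^ 4) (β ^ 4) Ω j) x) 2 volume =
        ENNReal.ofReal ‖φ - ∑ j ∈ s, c j • κ j‖ := by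
      intro s
      rw [← (toyTransform hα hβ).norm_map, ofReal_norm, Lp.enorm_def]
      refine eLpNorm_congr_ae ?_
      filter_upwards [coeFn_toyTransform_of_band hα hβ (hband s)] with x e
      rw [e, heval, toyMap_expInt_eq_inner α β (hband s)]
    simp only [h1]
    simpa using ENNReal.tendsto_ofReal hnorm
  · obtain ⟨M, hM⟩ := norm_toyKernelVec_le α β Ω
    rw [Metric.tendstoUniformly_iff]
    intro ε hε
    have hM' : Tendsto (fun s : Finset ℤ => M * ‖φ - ∑ j ∈ s, c j • κ j‖) atTop (𝓝 0) := by
      simpa using hnorm.const_mul M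
    filter_upwards [hM'.eventually_lt_const hε] with s hs x
    rw [dist_eq_norm, heval]
    refine ((norm_inner_le_norm _ _).trans ?_).trans_lt hs
    gcongr
    exact hM x
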